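/- Let $\pi:A\to M$ be a smooth ($C^\infty$) affine bundle of finite rank over a smooth manifold $M$, modelled on a vector bundle $\boldsymbol V\to M$. Let $\tilde A\to M$ be the vector bundle whose fibre over $m$ is the linear span $\tilde A_m=\mathrm{Aff}(A_m,\mathbb R)^*$ of $A_m$, let $i_1:A\to\tilde A$, $i_1(a)(\varphi)=\varphi(a)$, and $i_0:\boldsymbol V\to\tilde A$, $i_0(v)(\varphi)=\langle \text{linear part of }\varphi, v\rangle$, be the canonical embeddings (which will be omitted), and let $e^0=j:\tilde A\to\mathbb R$ be the fibrewise linear function given by evaluation on the constant function $1$, so that $A=j^{-1}(1)$ and $\boldsymbol V=j^{-1}(0)$. Sections of $\pi^*\tilde A$, $\pi^*\boldsymbol V$ are regarded as maps $\sigma$ from $A$ with $\sigma(a)\in\tilde A_{\pi(a)}$, $\boldsymbol V_{\pi(a)}$, and $\mathbb I(a)=a$ is the canonical section. The vertical lift is $\xi^{\mathsf V}(a,v)=\frac{d}{ds}(a+sv)|_{s=0}$ and $\sigma^{\mathsf V}=\xi^{\mathsf V}\circ\sigma$ (on $\boldsymbol V$-valued sections over $A$, and similarly on the vector bundle $\tilde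 A$). A connection on $A$ is a smooth splitting $\xi^{\mathsf H}:\pi^*TM\to TA$ of $TA\to\pi^*TM$; write $P_{\mathsf H}=\xi^{\mathsf H}\circ T\pi$ and $P_{\mathsf V}=\mathrm{id}-P_{\mathsf H}$ for its projectors and $\kappa$ for its connector map, $\xi^{\mathsf V}\circ\kappa=P_{\mathsf V}$. Its homogeneous extension is the connection $\xi^{\tilde{\mathsf H}}(\lambda a,v)=T\mu_\lambda(\xi^{\mathsf H}(a,v))$, $\lambda\ne0$, $a\in A$, on $\tilde A-\boldsymbol V$, where $\mu_\lambda(z)=\lambda z$; let $\tilde P_{\mathsf H},\tilde P_{\mathsf V},\tilde\kappa$ be its projectors and connector map, and let $$\tilde D_{\tilde U}\tilde\sigma=\tilde\kappa\bigl([\tilde P_{\mathsf H}(\tilde U),\tilde\sigma^{\mathsf V}]\bigr)+\tilde\kappa\bigl(T\tilde\sigma(\tilde P_{\mathsf V}(\tilde U))\bigr)$$ be its linearization, for a vector field $\tilde U$ on $\tilde A-\boldsymbol V$ and a section $\tilde\sigma$ of $\tilde A$ along $\tilde A-\boldsymbol V\to M$. Here and below, on a vertical vector tangent to $\tilde A$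 at any point, $\tilde\kappa$ (or $\kappa$) denotes the inverse of the vertical lift. The linearization $D$ of the connection on $A$ is the restriction of $\tilde D$ to $A$: for a smooth vector field $U$ on $A$ and a smooth section $\sigma$ of $\pi^*\tilde A$, $(D_U\sigma)(a)=(\tilde D_{\tilde U}\tilde\sigma)(a)$, $a\in A$, where $\tilde U$ is the homogeneous extension of $U$, $\tilde U(\lambda a)=T\mu_\lambda(U(a))$, and $\tilde\sigma(\lambda a)=\sigma(a)$, for $\lambda\ne 0$. Then, for every smooth vector field $U$ on $A$ and every smooth section $\sigma$ of $\pi^*\tilde A$: (1) $(D_U\sigma)(a)=(\tilde D_{\tilde U}\tilde\sigma)(a)$ for all $a\in A$ and for any smooth extensions $\tilde U$, $\tilde\sigma$ of $U$, $\sigma$ to $\tilde A-\boldsymbol V$; (2) $D$ is expressed in terms of vector fields on $A$ by $$D_U\sigma=\kappa\bigl([P_{\mathsf H}(U),\bar\sigma^{\mathsf V}]+T\sigma(P_{\mathsf V}(U))\bigr)+P_{\mathsf H}(U)(\langle e^0,\sigma\rangle)\,\mathbb I,\qquad \bar\sigma=\sigma-\langle e^0,\sigma\rangle\mathbb I\in\mathrm{Sec}(\pi^*\boldsymbol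 V),$$ where $\kappa$ of the sum means the sum of $\kappa$ of the two terms, which are tangent vectors at $a$ and (vertical) at $\sigma(a)$ respectively. -/

import Mathlib

set_option linter.unusedSectionVars false

open Set Bundle
open scoped Manifold ContDiff Topology

noncomputable section

/-! ### The linear span of an affine space -/

/-- The linear span `𝒜̃ = Aff(𝒜, ℝ)*` of a real affine space `P` modelled on the vector space `W`:
the dual of the vector space of real affine functions on `P`. -/
def LinSpan (W P : Type*) [AddCommGroup W] [Module ℝ W] [AddTorsor W P] : Type _ :=
  Module.Dual ℝ (P →ᵃ[ℝ] ℝ)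

namespace LinSpan

section

variable {W P : Type*} [AddCommGroup W] [Module ℝ W] [AddTorsor W P]

instance instAddCommGroup : AddCommGroup (LinSpan W P) :=
  inferInstanceAs (AddCommGroup (Module.Dual ℝ (P →ᵃ[ℝ] ℝ)))

instance instModule : Module ℝ (LinSpan W P) :=
  inferInstanceAs (Module ℝ (Module.Dual ℝ (P →ᵃ[ℝ] ℝ)))

/-- The canonical topology of a finite-dimensional real vector space. -/
instance instTopologicalSpace : TopologicalSpace (LinSpan W P) :=
  moduleTopology ℝ (LinSpan W P)

instance instIsModuleTopology : IsModuleTopology ℝ (LinSpan W P) := ⟨rfl⟩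

/-- The span, seen as the dual of the space of affine functions. -/
def toDual : LinSpan W P ≃ₗ[ℝ] Module.Dual ℝ (P →ᵃ[ℝ] ℝ) := LinearEquiv.refl ℝ _

/-- The pairing of an element of the span with an affine function. -/
def pair (z : LinSpan W P) (φ : P →ᵃ[ℝ] ℝ) : ℝ := toDual z φ

theorem ext_pair {z z' : LinSpan W P} (h : ∀ φ, z.pair φ = z'.pair φ) : z = z' :=
  LinearMap.ext h

/-- The embedding `i₁ : 𝒜 → 𝒜̃` given by evaluation, `i₁(a)(φ) = φ(a)`. -/
def i₁ (a : P) : LinSpan W P :=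
  toDual.symm
    { toFun := fun φ => φ a
      map_add' := fun _ _ => rfl
      map_smul' := fun _ _ => rfl }

/-- The embedding `i₀ : W → 𝒜̃`, dual to the map sending an affine function to its linear part. -/
def i₀ : W →ₗ[ℝ] LinSpan W P where
  toFun v := toDual.symm
    { toFun := fun φ => φ.linear v
      map_add' := fun _ _ => rfl
      map_smul' := fun _ _ => rfl }
  map_add' v w := LinearMap.ext fun φ => φ.linear.map_add v w
  map_smul' c v := LinearMap.ext fun φ => φ.linear.map_smul c v

/-- The linear function `j = e⁰ : 𝒜̃ → ℝ`, dual to the inclusion of the constants into the affine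
functions. -/
def j : LinSpan W P →ₗ[ℝ] ℝ where
  toFun z := z.pair (AffineMap.const ℝ P 1)
  map_add' _ _ := rfl
  map_smul' _ _ := rfl

@[simp] theorem pair_i₁ (a : P) (φ : P →ᵃ[ℝ] ℝ) : (i₁ (W := W) a).pair φ = φ a := rfl

@[simp] theorem pair_i₀ (v : W) (φ : P →ᵃ[ℝ] ℝ) : (i₀ (P := P) v).pair φ = φ.linear v := rfl

@[simp] theorem pair_add (z z' : LinSpan W P) (φ : P →ᵃ[ℝ] ℝ) :
    (z + z').pair φ = z.pair φ + z'.pair φ := rfl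

@[simp] theorem pair_smul (c : ℝ) (z : LinSpan W P) (φ : P →ᵃ[ℝ] ℝ) :
    (c • z).pair φ = c * z.pair φ := rfl

@[simp] theorem j_i₁ (a : P) : j (i₁ (W := W) a) = 1 := rfl

@[simp] theorem j_i₀ (v : W) : j (i₀ (P := P) v) = 0 := rfl

theorem pair_add_right (z : LinSpan W P) (φ ψ : P →ᵃ[ℝ] ℝ) :
    z.pair (φ + ψ) = z.pair φ + z.pair ψ := map_add (toDual z) φ ψ

theorem pair_smul_right (z : LinSpan W P) (c : ℝ) (φ : P →ᵃ[ℝ] ℝ) :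
    z.pair (c • φ) = c * z.pair φ := map_smul (toDual z) c φ

theorem i₁_vadd (v : W) (a : P) : i₁ (W := W) (v +ᵥ a) = i₀ v + i₁ a :=
  ext_pair fun φ => by simp

theorem i₀_injective [FiniteDimensional ℝ W] :
    Function.Injective (i₀ : W →ₗ[ℝ] LinSpan W P) := by
  rw [injective_iff_map_eq_zero]
  intro v hv
  obtain ⟨a⟩ := (inferInstance : Nonempty P)
  rw [← Module.forall_dual_apply_eq_zero_iff ℝ]
  intro l
  have h : (i₀ (P := P) v).pair
      (l.toAffineMap.comp ((AffineEquiv.vaddConst ℝ a).symm : P →ᵃ[ℝ] W)) = 0 := by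
    rw [hv]; rfl
  simpa using h

/-- Given a point `a`, every element `z` of the span is `j(z) i₁(a)` plus an element of `W`. -/
theorem exists_eq_add [FiniteDimensional ℝ W] (a : P) (z : LinSpan W P) :
    ∃ v : W, z = j z • i₁ a + i₀ v := by
  let ev : Module.Dual ℝ (Module.Dual ℝ W) :=
    { toFun := fun l =>
        z.pair (l.toAffineMap.comp ((AffineEquiv.vaddConst ℝ a).symm : P →ᵃ[ℝ] W))
      map_add' := fun l l' => by
        rw [← pair_add_right]; rfl
      map_smul' := fun c l => by
        rw [RingHom.id_apply, smul_eq_mul, ← pair_smul_right]; rfl }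
  refine ⟨(Module.evalEquiv ℝ W).symm ev, ext_pair fun φ => ?_⟩
  have h1 : φ.linear ((Module.evalEquiv ℝ W).symm ev) = ev φ.linear :=
    Module.apply_evalEquiv_symm_apply (R := ℝ) (M := W) φ.linear ev
  have h2 : φ = φ a • AffineMap.const ℝ P 1
      + φ.linear.toAffineMap.comp ((AffineEquiv.vaddConst ℝ a).symm : P →ᵃ[ℝ] W) := by
    ext p
    simp [AffineMap.linearMap_vsub]
  rw [pair_add, pair_smul, pair_i₁, pair_i₀, h1]
  conv_lhs => rw [h2, pair_add_right, pair_smul_right, mul_comm]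
  rfl

/-- The linear coordinates `(z⁰, z) ∈ ℝ × F` on the span defined by affine coordinates `f` on the
affine space: they are `(1, f(a))` at `i₁(a)`. -/
def coord {F : Type*} [AddCommGroup F] [Module ℝ F] [FiniteDimensional ℝ W]
    (f : P ≃ᵃ[ℝ] F) : LinSpan W P ≃ₗ[ℝ] ℝ × F :=
  LinearEquiv.symm <| LinearEquiv.ofBijective
    ((LinearMap.fst ℝ ℝ F).smulRight (i₁ (W := W) (f.symm 0))
      + (i₀ (P := P)).comp ((f.symm.linear : F →ₗ[ℝ] W).comp (LinearMap.snd ℝ ℝ F)))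
    (by
      constructor
      · rw [injective_iff_map_eq_zero]
        rintro ⟨t, w⟩ h
        have h' : t • i₁ (W := W) (f.symm 0) + i₀ (P := P) (f.symm.linear w) = 0 := h
        have ht : t = 0 := by simpa using congrArg j h'
        subst ht
        rw [zero_smul, zero_add, map_eq_zero_iff _ i₀_injective,
          map_eq_zero_iff _ f.symm.linear.injective] at h'
        simp [h']
      · intro z
        obtain ⟨v, hv⟩ := exists_eq_add (f.symm 0) z
        refine ⟨(j z, f.linear v), ?_⟩
        conv_rhs => rw [hv]
        change j z • i₁ (W := W) (f.symm 0) + i₀ (P := P) (f.linear.symm (f.linear v)) = _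
        rw [LinearEquiv.symm_apply_apply])

section coord

variable {F : Type*} [AddCommGroup F] [Module ℝ F] [FiniteDimensional ℝ W]

theorem coord_symm_apply (f : P ≃ᵃ[ℝ] F) (t : ℝ) (w : F) :
    (coord f).symm (t, w) = t • i₁ (f.symm 0) + i₀ (f.linear.symm w) := rfl

theorem coord_i₀ (f : P ≃ᵃ[ℝ] F) (v : W) : coord f (i₀ v) = (0, f.linear v) := by
  rw [← LinearEquiv.eq_symm_apply, coord_symm_apply]
  simp

theorem coord_i₁ (f : P ≃ᵃ[ℝ] F) (a : P) : coord f (i₁ a) = (1, f a) := by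
  rw [← LinearEquiv.eq_symm_apply, coord_symm_apply]
  rw [one_smul, add_comm, ← i₁_vadd]
  congr 1
  apply f.injective
  rw [AffineEquiv.map_vadd]
  simp

end coord

/-- The point `a` of the affine space with `z = j(z) i₁(a)`, for `j(z) ≠ 0`. -/
def dehom (z : LinSpan W P) : P := Classical.epsilon fun a : P => z = j z • i₁ a

theorem eq_smul_dehom [FiniteDimensional ℝ W] {z : LinSpan W P} (hz : j z ≠ 0) :
    z = j z • i₁ (dehom z) := by
  obtain ⟨a⟩ := (inferInstance : Nonempty P)
  obtain ⟨v, hv⟩ := exists_eq_add a z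
  have : ∃ b : P, z = j z • i₁ b := by
    refine ⟨((j z)⁻¹ • v) +ᵥ a, ?_⟩
    rw [i₁_vadd, smul_add, map_smul, smul_smul, mul_inv_cancel₀ hz, one_smul, add_comm]
    exact hv
  exact Classical.epsilon_spec this

/-- The component in `W` of an element `z` of the span, in the decomposition `⟨a⟩ ⊕ W` of the span
given by the point `a`: the vector with `z - j(z) i₁(a) = i₀(v)`. -/
def vecPart [FiniteDimensional ℝ W] (a : P) (z : LinSpan W P) : W :=
  (exists_eq_add a z).choose

theorem i₀_vecPart [FiniteDimensional ℝ W] (a : P) (z : LinSpan W P) :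
    i₀ (vecPart a z) = z - j z • i₁ a :=
  eq_sub_of_add_eq' (exists_eq_add a z).choose_spec.symm

end

end LinSpan

/-! ### Affine bundles -/

section AffineBundle

variable {M : Type*} [TopologicalSpace M]

/-- `A` is an affine bundle modelled on the vector bundle `V`: a fibre bundle whose fibres are
affine spaces modelled on the fibres of `V`, with local trivializations that are affine on the
fibres and continuous changes of trivialization. -/
class AffineBundle (F : Type*) [NormedAddCommGroup F] [NormedSpace ℝ F]
    (V : M → Type*) [∀ m, AddCommGroup (V m)] [∀ m, Module ℝ (V m)]
    [∀ m, TopologicalSpace (V m)] [TopologicalSpace (TotalSpace F V)] [FiberBundle F V]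
    (A : M → Type*) [∀ m, AddTorsor (V m) (A m)]
    [∀ m, TopologicalSpace (A m)] [TopologicalSpace (TotalSpace F A)] [FiberBundle F A] :
    Prop where
  exists_linearPart : ∀ e ∈ FiberBundle.trivializationAtlas F A,
    ∀ ε ∈ FiberBundle.trivializationAtlas F V, ∃ L : M → F →L[ℝ] F,
      ContinuousOn L (e.baseSet ∩ ε.baseSet) ∧
      ∀ m ∈ e.baseSet ∩ ε.baseSet, ∀ (v : V m) (a : A m),
        (e ⟨m, v +ᵥ a⟩).2 = L m (ε ⟨m, v⟩).2 + (e ⟨m, a⟩).2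
  exists_coordChange : ∀ e ∈ FiberBundle.trivializationAtlas F A,
    ∀ e' ∈ FiberBundle.trivializationAtlas F A, ∃ (g : M → F →L[ℝ] F) (b : M → F),
      ContinuousOn g (e.baseSet ∩ e'.baseSet) ∧ ContinuousOn b (e.baseSet ∩ e'.baseSet) ∧
      ∀ m ∈ e.baseSet ∩ e'.baseSet, ∀ a : A m,
        (e' ⟨m, a⟩).2 = g m (e ⟨m, a⟩).2 + b m

/-- The affine bundle `A` modelled on `V` is of class `C^n`: the linear parts of the local
trivializations of `A`, read in the trivializations of `V`, and the changes of trivialization,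
which are affine on the fibres, are of class `C^n`. -/
class ContMDiffAffineBundle (n : WithTop ℕ∞) {EB HB : Type*} [NormedAddCommGroup EB]
    [NormedSpace ℝ EB] [TopologicalSpace HB] (IB : ModelWithCorners ℝ EB HB) [ChartedSpace HB M]
    (F : Type*) [NormedAddCommGroup F] [NormedSpace ℝ F]
    (V : M → Type*) [∀ m, AddCommGroup (V m)] [∀ m, Module ℝ (V m)]
    [∀ m, TopologicalSpace (V m)] [TopologicalSpace (TotalSpace F V)] [FiberBundle F V]
    (A : M → Type*) [∀ m, AddTorsor (V m) (A m)]
    [∀ m, TopologicalSpace (A m)] [TopologicalSpace (TotalSpace F A)] [FiberBundle F A] :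
    Prop where
  exists_linearPart : ∀ e ∈ FiberBundle.trivializationAtlas F A,
    ∀ ε ∈ FiberBundle.trivializationAtlas F V, ∃ L : M → F →L[ℝ] F,
      ContMDiffOn IB 𝓘(ℝ, F →L[ℝ] F) n L (e.baseSet ∩ ε.baseSet) ∧
      ∀ m ∈ e.baseSet ∩ ε.baseSet, ∀ (v : V m) (a : A m),
        (e ⟨m, v +ᵥ a⟩).2 = L m (ε ⟨m, v⟩).2 + (e ⟨m, a⟩).2
  exists_coordChange : ∀ e ∈ FiberBundle.trivializationAtlas F A,
    ∀ e' ∈ FiberBundle.trivializationAtlas F A, ∃ (g : M → F →L[ℝ] F) (b : M → F),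
      ContMDiffOn IB 𝓘(ℝ, F →L[ℝ] F) n g (e.baseSet ∩ e'.baseSet) ∧
      ContMDiffOn IB 𝓘(ℝ, F) n b (e.baseSet ∩ e'.baseSet) ∧
      ∀ m ∈ e.baseSet ∩ e'.baseSet, ∀ a : A m,
        (e' ⟨m, a⟩).2 = g m (e ⟨m, a⟩).2 + b m

/-- The bundle `Ã → M` of the linear spans of the fibres of `A`. -/
def SpanBundle (V : M → Type*) [∀ m, AddCommGroup (V m)] [∀ m, Module ℝ (V m)]
    (A : M → Type*) [∀ m, AddTorsor (V m) (A m)] (m : M) : Type _ :=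
  LinSpan (V m) (A m)

section Algebra

variable {V : M → Type*} [∀ m, AddCommGroup (V m)] [∀ m, Module ℝ (V m)]
  {A : M → Type*} [∀ m, AddTorsor (V m) (A m)]

instance SpanBundle.instAddCommGroup (m : M) : AddCommGroup (SpanBundle V A m) :=
  inferInstanceAs (AddCommGroup (LinSpan (V m) (A m)))

instance SpanBundle.instModule (m : M) : Module ℝ (SpanBundle V A m) :=
  inferInstanceAs (Module ℝ (LinSpan (V m) (A m)))

instance SpanBundle.instTopologicalSpace (m : M) : TopologicalSpace (SpanBundle V A m) :=
  inferInstanceAs (TopologicalSpace (LinSpan (V m) (A m)))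

instance SpanBundle.instIsModuleTopology (m : M) : IsModuleTopology ℝ (SpanBundle V A m) :=
  inferInstanceAs (IsModuleTopology ℝ (LinSpan (V m) (A m)))

/-- The embedding `i₁ : A_m → Ã_m`. -/
def SpanBundle.i₁ {m : M} (a : A m) : SpanBundle V A m := LinSpan.i₁ (W := V m) a

/-- The embedding `i₀ : V_m → Ã_m`. -/
def SpanBundle.i₀ {m : M} (v : V m) : SpanBundle V A m := LinSpan.i₀ (P := A m) v

/-- The linear function `j = e⁰ : Ã_m → ℝ`. -/
def SpanBundle.j {m : M} (z : SpanBundle V A m) : ℝ := LinSpan.j (W := V m) (P := A m) z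

end Algebra

namespace AffineBundle

variable {F : Type*} [NormedAddCommGroup F] [NormedSpace ℝ F]
  {V : M → Type*} [∀ m, AddCommGroup (V m)] [∀ m, Module ℝ (V m)]
  [∀ m, TopologicalSpace (V m)] [TopologicalSpace (TotalSpace F V)] [FiberBundle F V]
  {A : M → Type*} [∀ m, AddTorsor (V m) (A m)]
  [∀ m, TopologicalSpace (A m)] [TopologicalSpace (TotalSpace F A)] [FiberBundle F A]

variable (F V) in
theorem finiteDimensional_fiber [VectorBundle ℝ F V] [FiniteDimensional ℝ F] (m : M) :
    FiniteDimensional ℝ (V m) :=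
  LinearEquiv.finiteDimensional
    ((trivializationAt F V m).linearEquivAt ℝ m (mem_baseSet_trivializationAt F V m)).symm

/-- The linear map `(t, w) ↦ (t, g w + t b)`, as a function of `g` and `b`. -/
def homogenize (p : (F →L[ℝ] F) × F) : (ℝ × F) →L[ℝ] (ℝ × F) :=
  (ContinuousLinearMap.inl ℝ ℝ F).comp (ContinuousLinearMap.fst ℝ ℝ F)
    + (ContinuousLinearMap.inr ℝ ℝ F).comp (p.1.comp (ContinuousLinearMap.snd ℝ ℝ F)
      + ContinuousLinearMap.smulRightL ℝ (ℝ × F) F (ContinuousLinearMap.fst ℝ ℝ F) p.2)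

theorem homogenize_apply (g : F →L[ℝ] F) (b : F) (w : ℝ × F) :
    homogenize (g, b) w = (w.1, g w.2 + w.1 • b) := by
  simp [homogenize]

theorem contDiff_homogenize {n : WithTop ℕ∞} : ContDiff ℝ n (homogenize (F := F)) := by
  unfold homogenize
  fun_prop

section Manifold

variable {n : WithTop ℕ∞} {EB HB : Type*} [NormedAddCommGroup EB]
    [NormedSpace ℝ EB] [TopologicalSpace HB] {IB : ModelWithCorners ℝ EB HB} [ChartedSpace HB M]

/-- The maps of `M × F` that are of class `C^n`. -/
def prodPregroupoid (n : WithTop ℕ∞) (IB : ModelWithCorners ℝ EB HB) (F : Type*)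
    [NormedAddCommGroup F] [NormedSpace ℝ F] : Pregroupoid (M × F) where
  property f s := ContMDiffOn (IB.prod 𝓘(ℝ, F)) (IB.prod 𝓘(ℝ, F)) n f s
  comp hf hg _ _ _ := hg.comp (hf.mono inter_subset_left) inter_subset_right
  id_mem := contMDiffOn_id
  locality _ h := contMDiffOn_of_locally_contMDiffOn h
  congr _ h hf := hf.congr h

variable (V) in
theorem contMDiffOn_change [ContMDiffAffineBundle n IB F V A] {e e' : Trivialization F (π F A)}
    (he : e ∈ FiberBundle.trivializationAtlas F A)
    (he' : e' ∈ FiberBundle.trivializationAtlas F A) :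
    ContMDiffOn (IB.prod 𝓘(ℝ, F)) (IB.prod 𝓘(ℝ, F)) n
      (e.toOpenPartialHomeomorph.symm.trans e'.toOpenPartialHomeomorph)
      (e.toOpenPartialHomeomorph.symm.trans e'.toOpenPartialHomeomorph).source := by
  obtain ⟨g, b, hg, hb, h⟩ :=
    ContMDiffAffineBundle.exists_coordChange (n := n) (IB := IB) (V := V) e he e' he'
  have hs : (e.toOpenPartialHomeomorph.symm.trans e'.toOpenPartialHomeomorph).source
      = (e.baseSet ∩ e'.baseSet) ×ˢ univ := e.symm_trans_source_eq e'
  rw [hs]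
  have hfst : ContMDiffOn (IB.prod 𝓘(ℝ, F)) IB n (Prod.fst : M × F → M)
    ((e.baseSet ∩ e'.baseSet) ×ˢ univ) := contMDiffOn_fst
  have hm : MapsTo (Prod.fst : M × F → M) ((e.baseSet ∩ e'.baseSet) ×ˢ univ)
    (e.baseSet ∩ e'.baseSet) := fun x hx => hx.1
  refine ContMDiffOn.congr (f := fun x : M × F => (x.1, g x.1 x.2 + b x.1))
    (hfst.prodMk (((hg.comp hfst hm).clm_apply contMDiffOn_snd).add (hb.comp hfst hm))) ?_
  rintro ⟨m, w⟩ ⟨hx, -⟩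
  have h1 : (m, w) ∈ e.target := e.mem_target.2 hx.1
  have h2 : (e.toOpenPartialHomeomorph.symm (m, w)).1 = m := e.proj_symm_apply' hx.1
  change e' (e.toOpenPartialHomeomorph.symm (m, w)) = _
  have h3 : e (e.toOpenPartialHomeomorph.symm (m, w)) = (m, w) := e.apply_symm_apply h1
  generalize e.toOpenPartialHomeomorph.symm (m, w) = q at h2 h3
  obtain ⟨m', a⟩ := q
  dsimp only at h2
  subst h2
  refine Prod.ext (e'.coe_fst' (proj := π F A) (x := ⟨m', a⟩) hx.2) ?_
  dsimp only
  rw [h m' hx a, h3]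

variable (n IB F V A) in
/-- The total space of a `C^n` affine bundle is a `C^n` manifold. -/
theorem isManifold [IsManifold IB n M] [ContMDiffAffineBundle n IB F V A] :
    IsManifold (IB.prod 𝓘(ℝ, F)) n (TotalSpace F A) := by
  have : HasGroupoid (TotalSpace F A) (prodPregroupoid (M := M) n IB F).groupoid := by
    refine ⟨?_⟩
    rintro _ _ ⟨e, he, rfl⟩ ⟨e', he', rfl⟩
    rw [mem_groupoid_of_pregroupoid]
    exact ⟨contMDiffOn_change V he he', contMDiffOn_change V he' he⟩
  refine { StructureGroupoid.HasGroupoid.comp (prodPregroupoid (M := M) n IB F).groupoid ?_ with }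
  intro f hf
  rw [isLocalStructomorphOn_contDiffGroupoid_iff]
  exact hf

end Manifold

variable [AffineBundle F V A]

variable (V) in
theorem exists_fiberEquiv [VectorBundle ℝ F V] {e : Trivialization F (π F A)}
    (he : e ∈ FiberBundle.trivializationAtlas F A) {m : M} (hm : m ∈ e.baseSet) :
    ∃ f : A m ≃ᵃ[ℝ] F, ∀ a, f a = (e ⟨m, a⟩).2 := by
  have hε := mem_baseSet_trivializationAt F V m
  set ε := trivializationAt F V m
  obtain ⟨L, -, hL⟩ := exists_linearPart (V := V) e he ε (FiberBundle.trivialization_mem_atlas' m)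
  have hb : Function.Bijective fun a : A m => (e ⟨m, a⟩).2 := by
    constructor
    · intro a a' h
      have h1 : e ⟨m, a⟩ = e ⟨m, a'⟩ :=
        Prod.ext ((e.coe_fst' (proj := π F A) (x := ⟨m, a⟩) hm).trans
        (e.coe_fst' (proj := π F A) (x := ⟨m, a'⟩) hm).symm) h
      have h2 := e.injOn (e.mem_source.2 hm) (e.mem_source.2 hm) h1
      simpa using h2
    · intro w
      have h1 : (m, w) ∈ e.target := e.mem_target.2 hm
      have h2 : (e.toOpenPartialHomeomorph.symm (m, w)).1 = m := e.proj_symm_apply' hm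
      generalize hq : e.toOpenPartialHomeomorph.symm (m, w) = q at h2
      obtain ⟨m', a⟩ := q
      dsimp only at h2
      subst h2
      refine ⟨a, ?_⟩
      dsimp only
      rw [← hq, e.apply_symm_apply h1]
  let g : A m →ᵃ[ℝ] F :=
    { toFun := fun a => (e ⟨m, a⟩).2
      linear := (L m : F →ₗ[ℝ] F).comp (ε.linearEquivAt ℝ m hε : V m →ₗ[ℝ] F)
      map_vadd' := fun a v => hL m ⟨hm, hε⟩ v a }
  exact ⟨AffineEquiv.ofBijective (φ := g) hb, fun _ => rfl⟩

variable (V) in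
/-- The affine coordinates on a fibre given by a local trivialization. -/
def fiberEquiv [VectorBundle ℝ F V] {e : Trivialization F (π F A)}
    (he : e ∈ FiberBundle.trivializationAtlas F A) {m : M} (hm : m ∈ e.baseSet) : A m ≃ᵃ[ℝ] F :=
  (exists_fiberEquiv V he hm).choose

theorem fiberEquiv_apply [VectorBundle ℝ F V] {e : Trivialization F (π F A)}
    (he : e ∈ FiberBundle.trivializationAtlas F A) {m : M} (hm : m ∈ e.baseSet) (a : A m) :
    fiberEquiv V he hm a = (e ⟨m, a⟩).2 :=
  (exists_fiberEquiv V he hm).choose_spec a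

variable [VectorBundle ℝ F V] [FiniteDimensional ℝ F]

open Classical in
variable (V) in
/-- The linear coordinates on the fibres of `Ã` induced by a local trivialization `e` of `A`, that
is `(1, e(a))` at `i₁(a)`; the value outside the base set of `e` is irrelevant. -/
def spanCoord (e : Trivialization F (π F A)) (m : M) : LinSpan (V m) (A m) →ₗ[ℝ] ℝ × F :=
  haveI := finiteDimensional_fiber F V m
  if h : e ∈ FiberBundle.trivializationAtlas F A ∧ m ∈ e.baseSet then
    (LinSpan.coord (fiberEquiv V h.1 h.2)).toLinearMap
  else 0

open Classical in
variable (V) in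
/-- The inverse of the linear coordinates on a fibre of `Ã`. -/
def spanCoordSymm (e : Trivialization F (π F A)) (m : M) : ℝ × F →ₗ[ℝ] LinSpan (V m) (A m) :=
  haveI := finiteDimensional_fiber F V m
  if h : e ∈ FiberBundle.trivializationAtlas F A ∧ m ∈ e.baseSet then
    (LinSpan.coord (fiberEquiv V h.1 h.2)).symm.toLinearMap
  else 0

theorem spanCoordSymm_spanCoord {e : Trivialization F (π F A)}
    (he : e ∈ FiberBundle.trivializationAtlas F A) {m : M} (hm : m ∈ e.baseSet)
    (z : LinSpan (V m) (A m)) : spanCoordSymm V e m (spanCoord V e m z) = z := by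
  have := finiteDimensional_fiber F V m
  rw [spanCoordSymm, spanCoord, dif_pos ⟨he, hm⟩, dif_pos ⟨he, hm⟩]
  exact LinearEquiv.symm_apply_apply (LinSpan.coord (fiberEquiv V he hm)) z

theorem spanCoord_spanCoordSymm {e : Trivialization F (π F A)}
    (he : e ∈ FiberBundle.trivializationAtlas F A) {m : M} (hm : m ∈ e.baseSet)
    (w : ℝ × F) : spanCoord V e m (spanCoordSymm V e m w) = w := by
  have := finiteDimensional_fiber F V m
  rw [spanCoordSymm, spanCoord, dif_pos ⟨he, hm⟩, dif_pos ⟨he, hm⟩]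
  exact LinearEquiv.apply_symm_apply (LinSpan.coord (fiberEquiv V he hm)) w

theorem spanCoord_i₁ {e : Trivialization F (π F A)}
    (he : e ∈ FiberBundle.trivializationAtlas F A) {m : M} (hm : m ∈ e.baseSet) (a : A m) :
    spanCoord V e m (LinSpan.i₁ (W := V m) a) = (1, (e ⟨m, a⟩).2) := by
  have := finiteDimensional_fiber F V m
  rw [spanCoord, dif_pos ⟨he, hm⟩, ← fiberEquiv_apply (V := V) he hm]
  exact LinSpan.coord_i₁ (fiberEquiv V he hm) a

theorem spanCoord_i₀ {e : Trivialization F (π F A)}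
    (he : e ∈ FiberBundle.trivializationAtlas F A) {m : M} (hm : m ∈ e.baseSet) (v : V m) :
    spanCoord V e m (LinSpan.i₀ (P := A m) v) = (0, (fiberEquiv V he hm).linear v) := by
  have := finiteDimensional_fiber F V m
  rw [spanCoord, dif_pos ⟨he, hm⟩]
  exact LinSpan.coord_i₀ (fiberEquiv V he hm) v

variable (V) in
/-- The local trivialization of `Ã` induced by a local trivialization of `A`. -/
def spanPretrivialization (e : Trivialization F (π F A))
    (he : e ∈ FiberBundle.trivializationAtlas F A) :
    Pretrivialization (ℝ × F) (π (ℝ × F) (SpanBundle V A)) where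
  toFun z := (z.1, spanCoord V e z.1 z.2)
  invFun w := ⟨w.1, spanCoordSymm V e w.1 w.2⟩
  source := π (ℝ × F) (SpanBundle V A) ⁻¹' e.baseSet
  target := e.baseSet ×ˢ univ
  map_source' _ hz := ⟨hz, mem_univ _⟩
  map_target' _ hw := hw.1
  left_inv' := by
    rintro ⟨m, z⟩ hz
    exact congrArg (TotalSpace.mk' (ℝ × F) (E := SpanBundle V A) m)
      (spanCoordSymm_spanCoord (V := V) he hz z)
  right_inv' := by
    rintro ⟨m, w⟩ hw
    dsimp only
    rw [spanCoord_spanCoordSymm he hw.1]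
  open_target := e.open_baseSet.prod isOpen_univ
  baseSet := e.baseSet
  open_baseSet := e.open_baseSet
  source_eq := rfl
  target_eq := rfl
  proj_toFun _ _ := rfl

theorem spanPretrivialization_symm (e : Trivialization F (π F A))
    (he : e ∈ FiberBundle.trivializationAtlas F A) {m : M} (hm : m ∈ e.baseSet) (w : ℝ × F) :
    (spanPretrivialization V e he).symm m w = spanCoordSymm V e m w := by
  rw [(spanPretrivialization V e he).symm_apply hm w]
  rfl

/-- The change of coordinates on `Ã` is `(t, w) ↦ (t, g w + t b)` if it is `y ↦ g y + b` on `A`. -/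
theorem spanCoord_change {e e' : Trivialization F (π F A)}
    (he : e ∈ FiberBundle.trivializationAtlas F A) (he' : e' ∈ FiberBundle.trivializationAtlas F A)
    {m : M} (hm : m ∈ e.baseSet ∩ e'.baseSet) {g : F →L[ℝ] F} {b : F}
    (hgb : ∀ a : A m, (e' ⟨m, a⟩).2 = g (e ⟨m, a⟩).2 + b) (w : ℝ × F) :
    spanCoord V e' m (spanCoordSymm V e m w) = (w.1, g w.2 + w.1 • b) := by
  have := finiteDimensional_fiber F V m
  obtain ⟨a⟩ := (inferInstance : Nonempty (A m))
  obtain ⟨z, rfl⟩ : ∃ z : LinSpan (V m) (A m), spanCoord V e m z = w :=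
    ⟨_, spanCoord_spanCoordSymm he hm.1 w⟩
  obtain ⟨v, hv⟩ := LinSpan.exists_eq_add a z
  have hlin : (fiberEquiv V he' hm.2).linear v = g ((fiberEquiv V he hm.1).linear v) := by
    have h1 := AffineEquiv.map_vadd (fiberEquiv V he' hm.2) a v
    have h2 := AffineEquiv.map_vadd (fiberEquiv V he hm.1) a v
    rw [fiberEquiv_apply, fiberEquiv_apply, hgb, hgb, ← fiberEquiv_apply (V := V) he hm.1, h2,
      ← fiberEquiv_apply (V := V) he hm.1] at h1
    simp only [vadd_eq_add, map_add] at h1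
    rw [add_assoc] at h1
    exact (add_right_cancel h1).symm
  rw [spanCoordSymm_spanCoord he hm.1, hv]
  simp only [map_add, map_smul, spanCoord_i₁ he hm.1, spanCoord_i₁ he' hm.2, spanCoord_i₀ he hm.1,
    spanCoord_i₀ he' hm.2, hgb, hlin]
  ext
  · simp
  · simp only [Prod.smul_mk, Prod.mk_add_mk, map_add, map_smul, smul_add, smul_eq_mul, mul_one,
      add_zero]
    abel

variable (F V A) in
/-- The vector bundle structure on `Ã`, given by the trivializations induced by those of `A`. -/
def spanPrebundle : VectorPrebundle ℝ (ℝ × F) (SpanBundle V A) where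
  pretrivializationAtlas :=
    {p | ∃ (e : Trivialization F (π F A)) (he : e ∈ FiberBundle.trivializationAtlas F A),
      p = spanPretrivialization V e he}
  pretrivialization_linear' := by
    rintro _ ⟨e, he, rfl⟩
    exact ⟨fun m _ => (spanCoord V e m).isLinear⟩
  pretrivializationAt m := spanPretrivialization V (trivializationAt F A m)
    (FiberBundle.trivialization_mem_atlas' m)
  mem_base_pretrivializationAt m := mem_baseSet_trivializationAt F A m
  pretrivialization_mem_atlas m := ⟨_, _, rfl⟩
  exists_coordChange := by
    rintro _ ⟨e, he, rfl⟩ _ ⟨e', he', rfl⟩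
    obtain ⟨g, b, hg, hb, h⟩ := exists_coordChange (V := V) e he e' he'
    refine ⟨fun m => homogenize (g m, b m),
      (contDiff_homogenize (F := F) (n := 0)).continuous.comp_continuousOn (hg.prodMk hb), ?_⟩
    intro m hm w
    rw [spanPretrivialization_symm e he hm.1, homogenize_apply]
    exact (spanCoord_change he he' hm (h m hm) w).symm
  totalSpaceMk_isInducing m := by
    have he := FiberBundle.trivialization_mem_atlas' (F := F) (E := A) m
    have hm := mem_baseSet_trivializationAt F A m
    set e := trivializationAt F A m
    have := finiteDimensional_fiber F V m
    let c : SpanBundle V A m ≃ₗ[ℝ] ℝ × F := LinSpan.coord (fiberEquiv V he hm)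
    have : IsModuleTopology ℝ (ℝ × F) := isModuleTopologyOfFiniteDimensional
    have : ContinuousAdd (SpanBundle V A m) :=
      IsModuleTopology.toContinuousAdd ℝ (SpanBundle V A m)
    let h : SpanBundle V A m ≃ₜ ℝ × F :=
      { c.toEquiv with
        continuous_toFun := IsModuleTopology.continuous_of_linearMap c.toLinearMap
        continuous_invFun := IsModuleTopology.continuous_of_linearMap c.symm.toLinearMap }
    have hp : Topology.IsInducing (Prod.mk m : ℝ × F → M × (ℝ × F)) := isInducing_prodMkRight m
    have := hp.comp h.isInducing
    convert this using 1
    funext z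
    refine Prod.ext rfl ?_
    change spanCoord V e m z = c z
    rw [spanCoord, dif_pos ⟨he, hm⟩]
    rfl

instance instTopologicalSpaceSpan : TopologicalSpace (TotalSpace (ℝ × F) (SpanBundle V A)) :=
  (spanPrebundle F V A).totalSpaceTopology

instance instFiberBundleSpan : FiberBundle (ℝ × F) (SpanBundle V A) :=
  (spanPrebundle F V A).toFiberBundle

instance instVectorBundleSpan : VectorBundle ℝ (ℝ × F) (SpanBundle V A) :=
  (spanPrebundle F V A).toVectorBundle

section Smooth

variable {n : WithTop ℕ∞} {EB HB : Type*} [NormedAddCommGroup EB]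
    [NormedSpace ℝ EB] [TopologicalSpace HB] {IB : ModelWithCorners ℝ EB HB} [ChartedSpace HB M]

theorem isContMDiff_spanPrebundle [ContMDiffAffineBundle n IB F V A] :
    (spanPrebundle F V A).IsContMDiff IB n where
  exists_contMDiffCoordChange := by
    rintro _ ⟨e, he, rfl⟩ _ ⟨e', he', rfl⟩
    obtain ⟨g, b, hg, hb, h⟩ :=
      ContMDiffAffineBundle.exists_coordChange (n := n) (IB := IB) (V := V) e he e' he'
    refine ⟨fun m => homogenize (g m, b m),
      (contDiff_homogenize (F := F)).contMDiff.comp_contMDiffOn (hg.prodMk_space hb), ?_⟩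
    intro m hm w
    rw [spanPretrivialization_symm e he hm.1, homogenize_apply]
    exact (spanCoord_change he he' hm (h m hm) w).symm

instance instContMDiffVectorBundleSpan [ContMDiffAffineBundle n IB F V A] :
    ContMDiffVectorBundle n (ℝ × F) (SpanBundle V A) IB :=
  haveI := isContMDiff_spanPrebundle (n := n) (IB := IB) (F := F) (V := V) (A := A)
  (spanPrebundle F V A).contMDiffVectorBundle IB

end Smooth

end AffineBundle

end AffineBundle

/-! ### Vertical lifts, connections and their linearization -/

/-- The model with corners of the total space of a fibre bundle with model fibre `F` over a manifold
without boundary modelled on `EB`. -/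
notation "𝓘T(" EB ", " F ")" =>
  ModelWithCorners.prod (modelWithCornersSelf ℝ EB) (modelWithCornersSelf ℝ F)

section Lifts

variable {M : Type*} [TopologicalSpace M]
  {EB : Type*} [NormedAddCommGroup EB] [NormedSpace ℝ EB] [ChartedSpace EB M]
  {F : Type*} [NormedAddCommGroup F] [NormedSpace ℝ F]
  {W : M → Type*} [∀ m, AddCommGroup (W m)] [∀ m, Module ℝ (W m)]
  {P : M → Type*} [∀ m, AddTorsor (W m) (P m)]
  [∀ m, TopologicalSpace (P m)] [TopologicalSpace (TotalSpace F P)] [FiberBundle F P]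

variable (EB) in
/-- The tangent map `Tπ` of the projection `π : P → M`. -/
def tangentProj (p : TotalSpace F P) :
    TangentSpace 𝓘T(EB, F) p →L[ℝ] TangentSpace 𝓘(ℝ, EB) p.1 :=
  mfderiv 𝓘T(EB, F) 𝓘(ℝ, EB) (π F P) p

variable (EB) in
/-- The vertical lift `ξⱽ(p, v) = d/ds (p + s v)` at `s = 0`. -/
def vLift (p : TotalSpace F P) (v : W p.1) : TangentSpace 𝓘T(EB, F) p :=
  mfderiv 𝓘(ℝ, ℝ) 𝓘T(EB, F)
    (fun s : ℝ => (⟨p.1, (s • v) +ᵥ p.2⟩ : TotalSpace F P)) 0 (1 : ℝ)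

variable (EB) in
/-- The inverse of the vertical lift at `p`, defined on vertical tangent vectors. -/
def vLiftInv (p : TotalSpace F P) (w : TangentSpace 𝓘T(EB, F) p) : W p.1 :=
  Function.invFun (vLift EB p) w

variable (EB F P) in
/-- A family of linear maps `T_{π(p)}M → T_p P`, the underlying data of a (not necessarily smooth,
or everywhere defined) horizontal lifting. -/
abbrev LiftData : Type _ :=
  ∀ p : TotalSpace F P, TangentSpace 𝓘(ℝ, EB) p.1 →L[ℝ] TangentSpace 𝓘T(EB, F) p

/-- The derivative `v(f)` of a function `f` on `P` along a tangent vector `v`. -/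
def tangentDeriv {p : TotalSpace F P} (v : TangentSpace 𝓘T(EB, F) p) (f : TotalSpace F P → ℝ) : ℝ :=
  mfderiv 𝓘T(EB, F) 𝓘(ℝ, ℝ) f p v

namespace LiftData

/-- The horizontal projector `P_H = ξᴴ ∘ Tπ`. -/
def projH (h : LiftData EB F P) (p : TotalSpace F P) :
    TangentSpace 𝓘T(EB, F) p →L[ℝ] TangentSpace 𝓘T(EB, F) p :=
  (h p).comp (tangentProj EB p)

/-- The vertical projector `P_V = id - P_H`. -/
def projV (h : LiftData EB F P) (p : TotalSpace F P) :
    TangentSpace 𝓘T(EB, F) p →L[ℝ] TangentSpace 𝓘T(EB, F) p :=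
  ContinuousLinearMap.id ℝ _ - h.projH p

/-- The connector map `κ`, determined by `ξⱽ ∘ κ = P_V`. -/
def connector (h : LiftData EB F P) (p : TotalSpace F P) (w : TangentSpace 𝓘T(EB, F) p) : W p.1 :=
  vLiftInv EB p (h.projV p w)

end LiftData

end Lifts

section VectorBundle

variable {M : Type*} [TopologicalSpace M]
  {EB : Type*} [NormedAddCommGroup EB] [NormedSpace ℝ EB] [ChartedSpace EB M]
  {F : Type*} [NormedAddCommGroup F] [NormedSpace ℝ F]
  {E : M → Type*} [∀ m, AddCommGroup (E m)] [∀ m, Module ℝ (E m)]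
  [∀ m, TopologicalSpace (E m)] [TopologicalSpace (TotalSpace F E)] [FiberBundle F E]

/-- The linearization `D_U σ = κ([P_H(U), σⱽ] + Tσ(P_V(U)))` of a nonlinear connection on the vector
bundle `E`, for a vector field `U` on `E` and a section `σ` of `E` along `π`. The two tangent
vectors in the formula have different base points `p` and `σ(p)` in the same fibre, so that `κ` is
applied to each of them. The second one is vertical. -/
def LiftData.covDeriv (h : LiftData EB F E) (U : ∀ p : TotalSpace F E, TangentSpace 𝓘T(EB, F) p)
    (σ : ∀ p : TotalSpace F E, E p.1) (p : TotalSpace F E) : E p.1 :=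
  h.connector p (VectorField.mlieBracket 𝓘T(EB, F) (fun q => h.projH q (U q))
      (fun q => vLift EB q (σ q)) p)
    + h.connector (⟨p.1, σ p⟩ : TotalSpace F E)
      (mfderiv 𝓘T(EB, F) 𝓘T(EB, F) (fun q => (⟨q.1, σ q⟩ : TotalSpace F E)) p (h.projV p (U p)))

variable (F E) in
/-- The multiplication map `μ_t`. -/
def scale (t : ℝ) (z : TotalSpace F E) : TotalSpace F E := ⟨z.1, t • z.2⟩

end VectorBundle

namespace AffineBundle

variable {M : Type*} [TopologicalSpace M]
  {EB : Type*} [NormedAddCommGroup EB] [NormedSpace ℝ EB] [ChartedSpace EB M]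
  {F : Type*} [NormedAddCommGroup F] [NormedSpace ℝ F] [FiniteDimensional ℝ F]
  {V : M → Type*} [∀ m, AddCommGroup (V m)] [∀ m, Module ℝ (V m)]
  [∀ m, TopologicalSpace (V m)] [TopologicalSpace (TotalSpace F V)] [FiberBundle F V]
  [VectorBundle ℝ F V]
  {A : M → Type*} [∀ m, AddTorsor (V m) (A m)]
  [∀ m, TopologicalSpace (A m)] [TopologicalSpace (TotalSpace F A)] [FiberBundle F A]

/-- A smooth map `X : N → TN` with `X(p) ∈ T_pN`, for `N` the total space of an affine bundle. -/
def IsSmoothVectorField [IsManifold 𝓘(ℝ, EB) ∞ M] [ContMDiffAffineBundle ∞ 𝓘(ℝ, EB) F V A]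
    (U : ∀ p : TotalSpace F A, TangentSpace 𝓘T(EB, F) p) : Prop :=
  haveI := isManifold F V A ∞ 𝓘(ℝ, EB)
  ContMDiff 𝓘T(EB, F) 𝓘T(EB, F).tangent ∞
    (fun p => (⟨p, U p⟩ : TangentBundle 𝓘T(EB, F) (TotalSpace F A)))

variable (EB F V A) in
/-- A (nonlinear) connection on the affine bundle `A → M`: a smooth splitting
`ξᴴ : π^*TM → TA` of the projection `TA → π^*TM`. Since that projection is a surjective submersion,
smoothness of `ξᴴ` is smoothness of the bundle map `P_H : TA → TA`. -/
structure Connection [IsManifold 𝓘(ℝ, EB) ∞ M] [ContMDiffAffineBundle ∞ 𝓘(ℝ, EB) F V A] where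
  lift : LiftData EB F A
  tangentProj_lift : ∀ (p : TotalSpace F A) (v : TangentSpace 𝓘(ℝ, EB) p.1),
    tangentProj EB p (lift p v) = v
  contMDiff_projH :
    haveI := isManifold F V A ∞ 𝓘(ℝ, EB)
    ContMDiff 𝓘T(EB, F).tangent 𝓘T(EB, F).tangent ∞
      (fun w : TangentBundle 𝓘T(EB, F) (TotalSpace F A) =>
        (⟨w.1, lift.projH w.1 w.2⟩ : TangentBundle 𝓘T(EB, F) (TotalSpace F A)))

variable (F V A) in
/-- The embedding `i₁ : A → Ã`. -/
def incl (p : TotalSpace F A) : TotalSpace (ℝ × F) (SpanBundle V A) :=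
  ⟨p.1, SpanBundle.i₁ p.2⟩

/-- The point `a` of `A` with `z = j(z) a`, for `z ∈ Ã - V`. -/
def base (z : TotalSpace (ℝ × F) (SpanBundle V A)) : TotalSpace F A :=
  ⟨z.1, LinSpan.dehom (W := V z.1) (P := A z.1) z.2⟩

theorem scale_incl_base (z : TotalSpace (ℝ × F) (SpanBundle V A)) (hz : SpanBundle.j z.2 ≠ 0) :
    scale (ℝ × F) (SpanBundle V A) (SpanBundle.j z.2) (incl F V A (base z)) = z := by
  have := finiteDimensional_fiber F V z.1
  exact congrArg (TotalSpace.mk' (ℝ × F) (E := SpanBundle V A) z.1)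
    (LinSpan.eq_smul_dehom (W := V z.1) (P := A z.1) hz).symm

/-- For `σ` a section of `Ã` along `π : A → M`, the section `σ̄ = σ - ⟨e⁰, σ⟩ 𝕀` of `V` along `π`. -/
def bar (σ : ∀ p : TotalSpace F A, SpanBundle V A p.1) (p : TotalSpace F A) : V p.1 :=
  haveI := finiteDimensional_fiber F V p.1
  LinSpan.vecPart (W := V p.1) p.2 (σ p)

theorem i₀_bar (σ : ∀ p : TotalSpace F A, SpanBundle V A p.1) (p : TotalSpace F A) :
    (SpanBundle.i₀ (bar σ p) : SpanBundle V A p.1) =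
      σ p - SpanBundle.j (σ p) • (SpanBundle.i₁ p.2 : SpanBundle V A p.1) :=
  haveI := finiteDimensional_fiber F V p.1
  LinSpan.i₀_vecPart (W := V p.1) p.2 (σ p)

variable [AffineBundle F V A]

/-- The homogeneous extension `T μ_t (T i₁ (X))`, at the point `z = t i₁(a)`, of a tangent vector
`X ∈ T_a A`, where `t = j(z) ≠ 0`. -/
def homogeneousTangent (z : TotalSpace (ℝ × F) (SpanBundle V A)) :
    TangentSpace 𝓘T(EB, F) (base z) →L[ℝ] TangentSpace 𝓘T(EB, ℝ × F) z :=
  (mfderiv 𝓘T(EB, ℝ × F) 𝓘T(EB, ℝ × F) (scale (ℝ × F) (SpanBundle V A) (SpanBundle.j z.2))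
    (incl F V A (base z))).comp (mfderiv 𝓘T(EB, F) 𝓘T(EB, ℝ × F) (incl F V A) (base z))

/-- The homogeneous extension to `Ã - V` of a connection on `A`,
`ξᴴ(t a, v) = T μ_t (ξᴴ(a, v))`. -/
def homogeneousLift (h : LiftData EB F A) : LiftData EB (ℝ × F) (SpanBundle V A) :=
  fun z => (homogeneousTangent z).comp (h (base z))

/-- The homogeneous extension to `Ã - V` of a vector field on `A`. -/
def homogeneousField (U : ∀ p : TotalSpace F A, TangentSpace 𝓘T(EB, F) p)
    (z : TotalSpace (ℝ × F) (SpanBundle V A)) : TangentSpace 𝓘T(EB, ℝ × F) z :=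
  homogeneousTangent z (U (base z))

/-- The extension to `Ã - V`, constant on rays, of a section of `Ã` along `A → M`. -/
def extendSection (σ : ∀ p : TotalSpace F A, SpanBundle V A p.1)
    (z : TotalSpace (ℝ × F) (SpanBundle V A)) : SpanBundle V A z.1 :=
  σ (base z)

/-- The linearization of a connection on the affine bundle `A`: the restriction to `A`
of the linearization of its homogeneous extension to `Ã - V`, evaluated on extensions of the vector
field `U` and of the section `σ` to `Ã - V`. -/
def Connection.linearization [IsManifold 𝓘(ℝ, EB) ∞ M]
    [ContMDiffAffineBundle ∞ 𝓘(ℝ, EB) F V A] (c : Connection EB F V A)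
    (U : ∀ p : TotalSpace F A, TangentSpace 𝓘T(EB, F) p)
    (σ : ∀ p : TotalSpace F A, SpanBundle V A p.1) (p : TotalSpace F A) : SpanBundle V A p.1 :=
  (homogeneousLift c.lift).covDeriv (homogeneousField U) (extendSection σ) (incl F V A p)

end AffineBundle

end

/-! Everything is computed in a bundle chart (x, y), where the horizontal projector reads (v, w) ↦
(v, N(x, y) v). Let u = (u₁, u₂) and s be the coordinate expressions of a vector field U and a
section σ.

On a vector bundle, the vertical part of [P_H(U), σⱽ] is ds(u₁, N u₁) − dN(0, s) u₁, because the
derivatives of u₁ cancel. The second term of the linearization is ds(0, u₂ − N u₁). The sum is D_U σ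
= ds(u) − dN(0, s) u₁ (`LiftData.HasCoeffAt.linearMapAt_covDeriv`), so that D depends on U only
through its value at the point.

A chart of A induces coordinates (x, t, w) on Ã, in which A is the slice t = 1 and the homogeneous
extension has coefficients (0, t N(x, w/t)). At a point of A an extension of U has no t-component,
hence ds is taken along A and sees only the restriction of the section. This gives (1), in
`AffineBundle.linearMapAt_covDeriv_of_extension`.

For (2), the derivative of the extended coefficients at (x, 1, y) in the direction (0, (r, w)) is
(0, dN(0, w − r y) + r N) (`AffineBundle.hasFDerivAt_homogeneousCoeff`). With (r, w) = s = (s₁, s₂),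
the vector w − r y is the coordinate of σ̄. On the other side, differentiating s₂ − s₁ y along the
horizontal vector (u₁, N u₁) produces −s₁ N u₁, which is the term r N, and −ds₁(u₁, N u₁) y, which
the term in 𝕀 = (1, y) cancels while supplying the missing e⁰-component
(`AffineBundle.linearMapAt_linearization_formula`). -/

/-! ### Tangent vectors, derivatives and Lie brackets in a chart -/

section ChartCoordinates

variable {E H N : Type*} [NormedAddCommGroup E] [NormedSpace ℝ E] [TopologicalSpace H]
  {I : ModelWithCorners ℝ E H} [TopologicalSpace N] [ChartedSpace H N]

variable (I) in
/-- The derivative at `q` of the extended chart at `p`. -/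
noncomputable def chartDeriv (p q : N) : TangentSpace I q →L[ℝ] E :=
  mfderiv I 𝓘(ℝ, E) (extChartAt I p) q

variable [IsManifold I 1 N]

theorem chartDeriv_isInvertible {p q : N} (hq : q ∈ (extChartAt I p).source) :
    (chartDeriv I p q).IsInvertible :=
  isInvertible_mfderiv_extChartAt hq

theorem chartDeriv_injective {p q : N} (hq : q ∈ (extChartAt I p).source) :
    Function.Injective (chartDeriv I p q) :=
  (chartDeriv_isInvertible hq).injective

/-- Smoothness of a vector field is tested in the trivializations of the tangent bundle. This turns
it into smoothness of the components `chartDeriv I p q (U q)`. -/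
theorem trivializationAt_tangent_apply {p q : N} (hq : q ∈ (extChartAt I p).source)
    (v : TangentSpace I q) :
    (trivializationAt E (TangentSpace I) p (⟨q, v⟩ : TangentBundle I N)).2
      = chartDeriv I p q v := by
  rw [extChartAt_source] at hq
  rw [chartDeriv, ← TangentBundle.continuousLinearMapAt_trivializationAt hq]
  rw [Trivialization.continuousLinearMapAt_apply, Trivialization.linearMapAt_apply, if_pos]
  simpa using hq

theorem eventually_mem_extChartAt_source (p : N) : ∀ᶠ q in 𝓝 p, q ∈ (extChartAt I p).source :=
  extChartAt_source_mem_nhds p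

/-- A map is differentiable if its expression in a chart is. -/
theorem mdifferentiableAt_of_extChartAt {E' H' N' : Type*} [NormedAddCommGroup E']
    [NormedSpace ℝ E'] [TopologicalSpace H'] {I' : ModelWithCorners ℝ E' H'} [TopologicalSpace N']
    [ChartedSpace H' N'] [I.Boundaryless] {f : N' → N} {x : N'} {p : N}
    (hs : ∀ᶠ y in 𝓝 x, f y ∈ (extChartAt I p).source)
    (hf : MDifferentiableAt I' 𝓘(ℝ, E) (fun y => extChartAt I p (f y)) x) :
    MDifferentiableAt I' I f x := by
  have h1 : MDifferentiableAt 𝓘(ℝ, E) I (extChartAt I p).symm (extChartAt I p (f x)) := by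
    have := mdifferentiableWithinAt_extChartAt_symm (I := I)
      ((extChartAt I p).map_source hs.self_of_nhds)
    rwa [I.range_eq_univ, mdifferentiableWithinAt_univ] at this
  refine (h1.comp x hf).congr_of_eventuallyEq ?_
  filter_upwards [hs] with y hy
  exact ((extChartAt I p).left_inv hy).symm

theorem mdifferentiableAt_extChartAt_of_mem {p q : N} (hq : q ∈ (extChartAt I p).source) :
    MDifferentiableAt I 𝓘(ℝ, E) (extChartAt I p) q :=
  mdifferentiableAt_extChartAt (by rwa [extChartAt_source] at hq)

theorem chartDeriv_mfderiv {E' H' N' : Type*} [NormedAddCommGroup E']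
    [NormedSpace ℝ E'] [TopologicalSpace H'] {I' : ModelWithCorners ℝ E' H'} [TopologicalSpace N']
    [ChartedSpace H' N'] {f : N' → N} {x : N'} {p : N}
    (hs : f x ∈ (extChartAt I p).source) (hf : MDifferentiableAt I' I f x)
    (v : TangentSpace I' x) :
    chartDeriv I p (f x) (mfderiv I' I f x v)
      = mfderiv I' 𝓘(ℝ, E) (fun y => extChartAt I p (f y)) x v := by
  have := mfderiv_comp x (mdifferentiableAt_extChartAt_of_mem hs) hf
  exact (congrArg (fun T => T v) this).symm

/-- The derivative of a map that reads `g` in the chart at `p`. -/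
theorem mfderiv_eq_fderiv_chartDeriv {G : Type*} [NormedAddCommGroup G] [NormedSpace ℝ G]
    {f : N → G} {g : E → G} {p q : N} (hq : q ∈ (extChartAt I p).source)
    (hfg : ∀ᶠ y in 𝓝 q, f y = g (extChartAt I p y))
    (hg : DifferentiableAt ℝ g (extChartAt I p q)) (v : TangentSpace I q) :
    mfderiv I 𝓘(ℝ, G) f q v = fderiv ℝ g (extChartAt I p q) (chartDeriv I p q v) := by
  rw [Filter.EventuallyEq.mfderiv_eq hfg]
  have := mfderiv_comp q hg.mdifferentiableAt (mdifferentiableAt_extChartAt_of_mem hq)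
  rw [mfderiv_eq_fderiv] at this
  exact congrArg (fun T => T v) this

theorem differentiableAt_comp_extChartAt_symm [I.Boundaryless] {G : Type*}
    [NormedAddCommGroup G] [NormedSpace ℝ G]
    {f : N → G} {p : N} (hf : MDifferentiableAt I 𝓘(ℝ, G) f p) :
    DifferentiableAt ℝ (fun x => f ((extChartAt I p).symm x)) (extChartAt I p p) := by
  have h1 : MDifferentiableAt 𝓘(ℝ, E) I (extChartAt I p).symm (extChartAt I p p) := by
    have := mdifferentiableWithinAt_extChartAt_symm (I := I) (mem_extChartAt_target (I := I) p)
    rwa [I.range_eq_univ, mdifferentiableWithinAt_univ] at this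
  rw [← extChartAt_to_inv (I := I) p] at hf
  exact (hf.comp _ h1).differentiableAt

/-- The Lie bracket of vector fields in the coordinates of a chart. -/
theorem chartDeriv_mlieBracket [I.Boundaryless] {p : N} {X Y : ∀ q : N, TangentSpace I q}
    {X' Y' : E → E}
    (hX : ∀ᶠ q in 𝓝 p, chartDeriv I p q (X q) = X' (extChartAt I p q))
    (hY : ∀ᶠ q in 𝓝 p, chartDeriv I p q (Y q) = Y' (extChartAt I p q)) :
    chartDeriv I p p (VectorField.mlieBracket I X Y p)
      = VectorField.lieBracket ℝ X' Y' (extChartAt I p p) := by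
  -- The manifold bracket is defined by pulling both fields back along the inverse chart. The
  -- pullback agrees with the coordinate expression on a whole neighbourhood, as needed to
  -- differentiate it.
  have key : ∀ {Z : ∀ q : N, TangentSpace I q} {Z' : E → E},
      (∀ᶠ q in 𝓝 p, chartDeriv I p q (Z q) = Z' (extChartAt I p q)) →
      VectorField.mpullbackWithin 𝓘(ℝ, E) I (extChartAt I p).symm Z (range I)
        =ᶠ[𝓝 (extChartAt I p p)] Z' := by
    intro Z Z' hZ
    have hc := (continuousAt_extChartAt_symm (I := I) p)
    have ht := extChartAt_target_mem_nhds (I := I) p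
    rw [ContinuousAt, extChartAt_to_inv] at hc
    filter_upwards [hc.eventually hZ, ht] with x hx hxt
    rw [(extChartAt I p).right_inv hxt] at hx
    rw [← hx, VectorField.mpullbackWithin_apply, chartDeriv]
    have h1 := mfderivWithin_extChartAt_symm_comp_mfderiv_extChartAt (I := I) hxt
    have h2 := mfderiv_extChartAt_comp_mfderivWithin_extChartAt_symm (I := I) hxt
    rw [ContinuousLinearMap.inverse_eq h1 h2]
    rfl
  have bracket : ∀ X₁ Y₁ : E → E, X₁ =ᶠ[𝓝 (extChartAt I p p)] X' →
      Y₁ =ᶠ[𝓝 (extChartAt I p p)] Y' →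
      VectorField.lieBracketWithin ℝ X₁ Y₁ ((extChartAt I p).symm ⁻¹' univ ∩ range I)
        (extChartAt I p p) = VectorField.lieBracket ℝ X' Y' (extChartAt I p p) := by
    intro X₁ Y₁ h h'
    rw [preimage_univ, univ_inter, I.range_eq_univ, VectorField.lieBracketWithin_univ]
    exact h.lieBracket_vectorField_eq h'
  rw [← VectorField.mlieBracketWithin_univ, VectorField.mlieBracketWithin_apply]
  exact ((chartDeriv_isInvertible (mem_extChartAt_source p)).self_apply_inverse _).trans
    (bracket _ _ (key hX) (key hY))

end ChartCoordinates

/-! ### Bundle charts, vertical lifts and connectors -/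

section BundleCharts

variable {M : Type*} [TopologicalSpace M]
  {EB : Type*} [NormedAddCommGroup EB] [NormedSpace ℝ EB] [ChartedSpace EB M]
  {F : Type*} [NormedAddCommGroup F] [NormedSpace ℝ F]
  {W : M → Type*} [∀ m, AddCommGroup (W m)] [∀ m, Module ℝ (W m)]
  {P : M → Type*} [∀ m, AddTorsor (W m) (P m)]
  [∀ m, TopologicalSpace (P m)] [TopologicalSpace (TotalSpace F P)] [FiberBundle F P]

/-- Membership depends on the base point alone: the chart domain is a union of whole fibres. Moving
inside a fibre, as vertical lifts, `incl`, `base` and `scale` do, therefore never leaves the chart.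
-/
theorem mem_bundleChart_source {p q : TotalSpace F P} :
    q ∈ (extChartAt 𝓘T(EB, F) p).source ↔
      q.1 ∈ (trivializationAt F P p.1).baseSet ∧ q.1 ∈ (extChartAt 𝓘(ℝ, EB) p.1).source := by
  rw [FiberBundle.extChartAt]
  simp only [PartialEquiv.trans_source, PartialEquiv.prod_source, PartialEquiv.refl_source,
    mem_inter_iff, mem_preimage, mem_prod, mem_univ, and_true]
  change q ∈ (trivializationAt F P p.1).source ∧ _ ↔ _
  rw [Trivialization.mem_source]
  refine and_congr_right fun h => ?_
  change (trivializationAt F P p.1 q).1 ∈ _ ↔ _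
  rw [Trivialization.coe_fst' _ h]

theorem bundleChart_apply {p q : TotalSpace F P} (hq : q.1 ∈ (trivializationAt F P p.1).baseSet) :
    extChartAt 𝓘T(EB, F) p q
      = (extChartAt 𝓘(ℝ, EB) p.1 q.1, (trivializationAt F P p.1 q).2) := by
  rw [FiberBundle.extChartAt]
  change (extChartAt 𝓘(ℝ, EB) p.1 (trivializationAt F P p.1 q).1, _) = _
  rw [Trivialization.coe_fst' _ hq]
  rfl

theorem eventually_mem_bundleChart_source {p q : TotalSpace F P}
    (hq : q ∈ (extChartAt 𝓘T(EB, F) p).source) :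
    ∀ᶠ y in 𝓝 q, y ∈ (extChartAt 𝓘T(EB, F) p).source :=
  (isOpen_extChartAt_source p).mem_nhds hq

variable [IsManifold 𝓘(ℝ, EB) 1 M] [IsManifold 𝓘T(EB, F) 1 (TotalSpace F P)]

/-- In a bundle chart, π is the first projection. -/
theorem fst_chartDeriv {p q : TotalSpace F P} (hq : q ∈ (extChartAt 𝓘T(EB, F) p).source)
    (w : TangentSpace 𝓘T(EB, F) q) :
    (chartDeriv 𝓘T(EB, F) p q w).1 = chartDeriv 𝓘(ℝ, EB) p.1 q.1 (tangentProj EB q w) := by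
  have h1 : MDifferentiableAt 𝓘T(EB, F) 𝓘(ℝ, EB) (π F P) q :=
    (contMDiffAt_proj P (n := 1)).mdifferentiableAt one_ne_zero
  rw [tangentProj]
  have h2 := chartDeriv_mfderiv (p := p.1) (mem_bundleChart_source.1 hq).2 h1 w
  refine Eq.trans ?_ h2.symm
  refine (mfderiv_eq_fderiv_chartDeriv (g := Prod.fst) hq ?_ differentiableAt_fst w).trans ?_ |>.symm
  · filter_upwards [eventually_mem_bundleChart_source hq] with y hy
    rw [bundleChart_apply (mem_bundleChart_source.1 hy).1]
  · rw [fderiv_fst]; rfl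

theorem tangentProj_eq_zero {p q : TotalSpace F P} (hq : q ∈ (extChartAt 𝓘T(EB, F) p).source)
    {w : TangentSpace 𝓘T(EB, F) q} (hw : (chartDeriv 𝓘T(EB, F) p q w).1 = 0) :
    tangentProj EB q w = 0 := by
  rw [fst_chartDeriv hq] at hw
  exact chartDeriv_injective (mem_bundleChart_source.1 hq).2 (hw.trans (map_zero _).symm)

/-- The vertical lift of `v` is `(0, L v)` in coordinates that are affine on the fibre with linear
part `L`. -/
theorem chartDeriv_vLift {p q : TotalSpace F P} (hq : q ∈ (extChartAt 𝓘T(EB, F) p).source)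
    {L : W q.1 →ₗ[ℝ] F} (hL : ∀ (v : W q.1) (a : P q.1),
      (trivializationAt F P p.1 ⟨q.1, v +ᵥ a⟩).2 = L v + (trivializationAt F P p.1 ⟨q.1, a⟩).2)
    (v : W q.1) : chartDeriv 𝓘T(EB, F) p q (vLift EB q v) = (0, L v) := by
  set f : ℝ → TotalSpace F P := fun s => ⟨q.1, (s • v) +ᵥ q.2⟩ with hf
  have hs : ∀ s, f s ∈ (extChartAt 𝓘T(EB, F) p).source := fun s =>
    (mem_bundleChart_source (q := f s)).2 ((mem_bundleChart_source (q := q)).1 hq)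
  have hc : (fun s => extChartAt 𝓘T(EB, F) p (f s)) = fun s : ℝ =>
      (extChartAt 𝓘(ℝ, EB) p.1 q.1, s • L v + (trivializationAt F P p.1 q).2) := by
    funext s
    rw [bundleChart_apply (mem_bundleChart_source.1 (hs s)).1, hf]
    dsimp only
    rw [hL, map_smul]
  have hd : HasFDerivAt (fun s : ℝ =>
      (extChartAt 𝓘(ℝ, EB) p.1 q.1, s • L v + (trivializationAt F P p.1 q).2))
      ((0 : ℝ →L[ℝ] EB).prod ((ContinuousLinearMap.id ℝ ℝ).smulRight (L v))) 0 := by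
    refine (hasFDerivAt_const _ _).prodMk (HasFDerivAt.add_const _ ?_)
    exact (hasFDerivAt_id (0 : ℝ)).smul_const (L v)
  have hm : MDifferentiableAt 𝓘(ℝ, ℝ) 𝓘T(EB, F) f 0 := by
    refine mdifferentiableAt_of_extChartAt (p := p) (.of_forall hs) ?_
    rw [hc]
    exact hd.differentiableAt.mdifferentiableAt
  have h0 : f 0 = q := by simp [hf]
  have h1 := chartDeriv_mfderiv (p := p) (hs 0) hm (1 : ℝ)
  rw [hc, mfderiv_eq_fderiv, hd.fderiv] at h1
  -- The curve starts at `f 0`, which equals q only propositionally, while the tangent space depends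
  -- on the point. Generalizing the endpoint allows substitution.
  have h2 : ∀ q', f 0 = q' →
      chartDeriv 𝓘T(EB, F) p q' (mfderiv 𝓘(ℝ, ℝ) 𝓘T(EB, F) f 0 (1 : ℝ)) = (0, L v) := by
    rintro _ rfl
    refine h1.trans ?_
    change ((0 : EB), (1 : ℝ) • L v) = _
    rw [one_smul]
  exact h2 q h0

/-- `vLiftInv` is a mere `Function.invFun`. It is meaningful because injectivity of L makes the
vertical lift injective, and w is seen to lie in its range by comparing coordinates. -/
theorem vLiftInv_eq {p q : TotalSpace F P} (hq : q ∈ (extChartAt 𝓘T(EB, F) p).source)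
    {L : W q.1 →ₗ[ℝ] F} (hL : ∀ (v : W q.1) (a : P q.1),
      (trivializationAt F P p.1 ⟨q.1, v +ᵥ a⟩).2 = L v + (trivializationAt F P p.1 ⟨q.1, a⟩).2)
    (hinj : Function.Injective L) {w : TangentSpace 𝓘T(EB, F) q} {v : W q.1}
    (hw : chartDeriv 𝓘T(EB, F) p q w = (0, L v)) : vLiftInv EB q w = v := by
  have h1 : Function.Injective (vLift EB q : W q.1 → TangentSpace 𝓘T(EB, F) q) := by
    intro v v' h
    have h2 := chartDeriv_vLift hq hL v
    rw [h, chartDeriv_vLift hq hL v'] at h2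
    exact hinj (congrArg Prod.snd h2).symm
  have h2 : w = vLift EB q v := chartDeriv_injective hq (hw.trans (chartDeriv_vLift hq hL v).symm)
  rw [h2]
  exact Function.leftInverse_invFun h1 v

namespace LiftData

/-- A vertical vector is killed by Tπ, hence by `projH`, whatever the lift is at q. So the connector
may be applied at σ(p) even where the homogeneous lift is meaningless, as on V ⊂ Ã. -/
theorem connector_eq_vLiftInv (h : LiftData EB F P) {p q : TotalSpace F P}
    (hq : q ∈ (extChartAt 𝓘T(EB, F) p).source)
    {w : TangentSpace 𝓘T(EB, F) q} (hw : (chartDeriv 𝓘T(EB, F) p q w).1 = 0) :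
    (h.connector q w : W q.1) = vLiftInv EB q w := by
  have h1 : h.projH q w = 0 := by
    rw [projH, ContinuousLinearMap.comp_apply, tangentProj_eq_zero hq hw, map_zero]
  rw [connector, projV, sub_apply, h1, sub_zero]
  rfl

/-- The horizontal projector at `q` is `(v, w) ↦ (v, N v)` in the chart at `p`. -/
noncomputable def HasCoeffAt (h : LiftData EB F P) (p q : TotalSpace F P) (N : EB →L[ℝ] F) : Prop :=
  ∀ w, chartDeriv 𝓘T(EB, F) p q (h.projH q w)
    = ((chartDeriv 𝓘T(EB, F) p q w).1, N (chartDeriv 𝓘T(EB, F) p q w).1)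

variable {h : LiftData EB F P}

theorem HasCoeffAt.chartDeriv_projV {p q : TotalSpace F P} {N : EB →L[ℝ] F}
    (hN : h.HasCoeffAt p q N) (w : TangentSpace 𝓘T(EB, F) q) :
    chartDeriv 𝓘T(EB, F) p q (h.projV q w)
      = (0, (chartDeriv 𝓘T(EB, F) p q w).2 - N (chartDeriv 𝓘T(EB, F) p q w).1) := by
  rw [projV, sub_apply, map_sub, hN w]
  exact Prod.ext (sub_self _) rfl

theorem HasCoeffAt.connector_eq {p q : TotalSpace F P} {N : EB →L[ℝ] F}
    (hN : h.HasCoeffAt p q N) (hq : q ∈ (extChartAt 𝓘T(EB, F) p).source)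
    {L : W q.1 →ₗ[ℝ] F} (hL : ∀ (v : W q.1) (a : P q.1),
      (trivializationAt F P p.1 ⟨q.1, v +ᵥ a⟩).2 = L v + (trivializationAt F P p.1 ⟨q.1, a⟩).2)
    (hinj : Function.Injective L) {w : TangentSpace 𝓘T(EB, F) q} {v : W q.1}
    (hw : L v = (chartDeriv 𝓘T(EB, F) p q w).2 - N (chartDeriv 𝓘T(EB, F) p q w).1) :
    h.connector q w = v := by
  refine vLiftInv_eq hq hL hinj ?_
  rw [hN.chartDeriv_projV, hw]

/-- The vertical component of the bracket of a horizontal and a vertical field. -/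
theorem HasCoeffAt.mlieBracket_projH {p : TotalSpace F P} {N : EB × F → EB →L[ℝ] F}
    (hN : ∀ᶠ q in 𝓝 p, h.HasCoeffAt p q (N (extChartAt 𝓘T(EB, F) p q)))
    (hNd : DifferentiableAt ℝ N (extChartAt 𝓘T(EB, F) p p))
    {U Y : ∀ q : TotalSpace F P, TangentSpace 𝓘T(EB, F) q} {U' : EB × F → EB × F}
    {s : EB × F → F}
    (hU : ∀ᶠ q in 𝓝 p, chartDeriv 𝓘T(EB, F) p q (U q) = U' (extChartAt 𝓘T(EB, F) p q))
    (hUd : DifferentiableAt ℝ U' (extChartAt 𝓘T(EB, F) p p))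
    (hY : ∀ᶠ q in 𝓝 p, chartDeriv 𝓘T(EB, F) p q (Y q) = (0, s (extChartAt 𝓘T(EB, F) p q)))
    (hsd : DifferentiableAt ℝ s (extChartAt 𝓘T(EB, F) p p)) :
    (chartDeriv 𝓘T(EB, F) p p
        (VectorField.mlieBracket 𝓘T(EB, F) (fun q => h.projH q (U q)) Y p)).2
      - N (extChartAt 𝓘T(EB, F) p p) (chartDeriv 𝓘T(EB, F) p p
        (VectorField.mlieBracket 𝓘T(EB, F) (fun q => h.projH q (U q)) Y p)).1
      = fderiv ℝ s (extChartAt 𝓘T(EB, F) p p)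
          ((U' (extChartAt 𝓘T(EB, F) p p)).1,
            N (extChartAt 𝓘T(EB, F) p p) (U' (extChartAt 𝓘T(EB, F) p p)).1)
        - fderiv ℝ N (extChartAt 𝓘T(EB, F) p p) (0, s (extChartAt 𝓘T(EB, F) p p))
          (U' (extChartAt 𝓘T(EB, F) p p)).1 := by
  rw [chartDeriv_mlieBracket (X' := fun x => ((U' x).1, N x (U' x).1)) (Y' := fun x => (0, s x))
    (by filter_upwards [hN, hU] with q hq hq'; rw [hq, hq']) hY]
  generalize extChartAt 𝓘T(EB, F) p p = x at *
  have d1 : HasFDerivAt (fun x => (U' x).1)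
      ((ContinuousLinearMap.fst ℝ EB F).comp (fderiv ℝ U' x)) x := hUd.hasFDerivAt.fst
  have d2 := d1.prodMk (hNd.hasFDerivAt.clm_apply d1)
  have d3 := (hasFDerivAt_const (0 : EB) x).prodMk hsd.hasFDerivAt
  -- The bracket has first component −dU'₁(0, s). Subtracting N of it cancels the product-rule term
  -- N dU'₁(0, s) in the second component.
  rw [VectorField.lieBracket, d2.fderiv, d3.fderiv]
  simp only [ContinuousLinearMap.prod_apply, add_apply,
    ContinuousLinearMap.comp_apply, ContinuousLinearMap.flip_apply, Prod.fst_sub, Prod.snd_sub,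
    zero_apply, zero_sub, map_neg]
  abel

end LiftData

end BundleCharts

/-! ### The linearization on a vector bundle in coordinates -/

section CovariantDerivative

variable {M : Type*} [TopologicalSpace M]
  {EB : Type*} [NormedAddCommGroup EB] [NormedSpace ℝ EB] [ChartedSpace EB M]
  {F : Type*} [NormedAddCommGroup F] [NormedSpace ℝ F]
  {E : M → Type*} [∀ m, AddCommGroup (E m)] [∀ m, Module ℝ (E m)]
  [∀ m, TopologicalSpace (E m)] [TopologicalSpace (TotalSpace F E)] [FiberBundle F E]
  [VectorBundle ℝ F E]
  [IsManifold 𝓘(ℝ, EB) 1 M] [IsManifold 𝓘T(EB, F) 1 (TotalSpace F E)]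

/-- A vector bundle is affine over itself. This provides the linear part L that the lemmas on
vertical lifts require. -/
theorem trivialization_vadd {m m' : M} (hm : m ∈ (trivializationAt F E m').baseSet) (v a : E m) :
    (trivializationAt F E m' ⟨m, v +ᵥ a⟩).2
      = (trivializationAt F E m').linearMapAt ℝ m v + (trivializationAt F E m' ⟨m, a⟩).2 := by
  have h : ∀ z : E m, (trivializationAt F E m' ⟨m, z⟩).2
      = (trivializationAt F E m').linearMapAt ℝ m z := fun z => by
    rw [Trivialization.linearMapAt_apply, if_pos hm]
  rw [h, h, vadd_eq_add, map_add]

theorem linearMapAt_injective {m m' : M} (hm : m ∈ (trivializationAt F E m').baseSet) :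
    Function.Injective ((trivializationAt F E m').linearMapAt ℝ m) := by
  rw [Trivialization.linearMapAt_def_of_mem _ hm]
  exact LinearEquiv.injective _

theorem exists_linearMapAt_eq {m m' : M} (hm : m ∈ (trivializationAt F E m').baseSet) (y : F) :
    ∃ v, (trivializationAt F E m').linearMapAt ℝ m v = y := by
  rw [Trivialization.linearMapAt_def_of_mem _ hm]
  exact LinearEquiv.surjective _ y

variable {F' : Type*} [NormedAddCommGroup F'] [NormedSpace ℝ F']
  {P : M → Type*} [∀ m, TopologicalSpace (P m)] [TopologicalSpace (TotalSpace F' P)]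
  [FiberBundle F' P] [IsManifold 𝓘T(EB, F') 1 (TotalSpace F' P)]

section Section

variable {σ : ∀ q : TotalSpace F' P, E q.1} {p : TotalSpace F' P} {s : EB × F' → F}

/-- The charts at p and at σ(p) are built over the same chart of M, so the map q ↦ σ(q) reads (x, y)
↦ (x, s(x, y)). -/
theorem extChartAt_section (hs : ∀ᶠ q in 𝓝 p, (trivializationAt F E p.1 ⟨q.1, σ q⟩).2
      = s (extChartAt 𝓘T(EB, F') p q)) :
    ∀ᶠ q in 𝓝 p, (⟨q.1, σ q⟩ : TotalSpace F E) ∈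
        (extChartAt 𝓘T(EB, F) (⟨p.1, σ p⟩ : TotalSpace F E)).source ∧
      extChartAt 𝓘T(EB, F) (⟨p.1, σ p⟩ : TotalSpace F E) (⟨q.1, σ q⟩ : TotalSpace F E)
        = ((extChartAt 𝓘T(EB, F') p q).1, s (extChartAt 𝓘T(EB, F') p q)) := by
  have hb := (FiberBundle.continuous_proj F' P).continuousAt.preimage_mem_nhds
    ((trivializationAt F E p.1).open_baseSet.mem_nhds (mem_baseSet_trivializationAt F E p.1))
  filter_upwards [hs, eventually_mem_extChartAt_source (I := 𝓘T(EB, F')) p, hb] with q hq hq' hq''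
  have hq1 := mem_bundleChart_source.1 hq'
  refine ⟨mem_bundleChart_source.2 ⟨hq'', hq1.2⟩, ?_⟩
  rw [bundleChart_apply (p := (⟨p.1, σ p⟩ : TotalSpace F E)) (q := ⟨q.1, σ q⟩) hq'']
  refine Prod.ext ?_ hq
  rw [bundleChart_apply hq1.1]

theorem chartDeriv_mfderiv_section
    (hs : ∀ᶠ q in 𝓝 p, (trivializationAt F E p.1 ⟨q.1, σ q⟩).2 = s (extChartAt 𝓘T(EB, F') p q))
    (hsd : DifferentiableAt ℝ s (extChartAt 𝓘T(EB, F') p p)) (w : TangentSpace 𝓘T(EB, F') p) :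
    chartDeriv 𝓘T(EB, F) (⟨p.1, σ p⟩ : TotalSpace F E) ⟨p.1, σ p⟩
      (mfderiv 𝓘T(EB, F') 𝓘T(EB, F) (fun q => (⟨q.1, σ q⟩ : TotalSpace F E)) p w)
      = ((chartDeriv 𝓘T(EB, F') p p w).1,
        fderiv ℝ s (extChartAt 𝓘T(EB, F') p p) (chartDeriv 𝓘T(EB, F') p p w)) := by
  have hsec := extChartAt_section (F := F) (E := E) hs
  have hd : DifferentiableAt ℝ (fun x : EB × F' => (x.1, s x)) (extChartAt 𝓘T(EB, F') p p) :=
    differentiableAt_fst.prodMk hsd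
  have hc : (fun q => extChartAt 𝓘T(EB, F) (⟨p.1, σ p⟩ : TotalSpace F E)
      (⟨q.1, σ q⟩ : TotalSpace F E)) =ᶠ[𝓝 p]
      (fun x : EB × F' => (x.1, s x)) ∘ extChartAt 𝓘T(EB, F') p := hsec.mono fun q hq => hq.2
  have hm : MDifferentiableAt 𝓘T(EB, F') 𝓘T(EB, F)
      (fun q => (⟨q.1, σ q⟩ : TotalSpace F E)) p := by
    refine mdifferentiableAt_of_extChartAt (p := (⟨p.1, σ p⟩ : TotalSpace F E))
      (hsec.mono fun q hq => hq.1) ?_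
    exact (hd.mdifferentiableAt.comp p (mdifferentiableAt_extChartAt_of_mem
      (mem_extChartAt_source p))).congr_of_eventuallyEq hc
  refine (chartDeriv_mfderiv (mem_extChartAt_source _) hm w).trans ?_
  refine (mfderiv_eq_fderiv_chartDeriv (p := p) (g := fun x : EB × F' => (x.1, s x))
    (mem_extChartAt_source _) hc hd w).trans ?_
  rw [(hasFDerivAt_fst.prodMk hsd.hasFDerivAt).fderiv]
  rfl

theorem linearMapAt_vLiftInv_mfderiv_section
    (hs : ∀ᶠ q in 𝓝 p, (trivializationAt F E p.1 ⟨q.1, σ q⟩).2 = s (extChartAt 𝓘T(EB, F') p q))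
    (hsd : DifferentiableAt ℝ s (extChartAt 𝓘T(EB, F') p p)) {w : TangentSpace 𝓘T(EB, F') p}
    (hw : (chartDeriv 𝓘T(EB, F') p p w).1 = 0) :
    (trivializationAt F E p.1).linearMapAt ℝ p.1
      (vLiftInv EB (⟨p.1, σ p⟩ : TotalSpace F E)
        (mfderiv 𝓘T(EB, F') 𝓘T(EB, F) (fun q => (⟨q.1, σ q⟩ : TotalSpace F E)) p w))
      = fderiv ℝ s (extChartAt 𝓘T(EB, F') p p) (chartDeriv 𝓘T(EB, F') p p w) := by
  have hm := mem_baseSet_trivializationAt F E p.1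
  obtain ⟨v, hv⟩ := exists_linearMapAt_eq hm
    (fderiv ℝ s (extChartAt 𝓘T(EB, F') p p) (chartDeriv 𝓘T(EB, F') p p w))
  have h1 := chartDeriv_mfderiv_section hs hsd w
  rw [hw, ← hv] at h1
  rw [← hv]
  congr 1
  exact vLiftInv_eq (mem_extChartAt_source _) (trivialization_vadd hm) (linearMapAt_injective hm) h1

end Section

/-- The bracket contributes ds(u₁, N u₁) − dN(0, s) u₁ and the vertical term ds(0, u₂ − N u₁), where
u is the value of U' at p. The two derivatives of s add up to ds(u), and no derivative of U'
survives. -/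
theorem LiftData.HasCoeffAt.linearMapAt_covDeriv {h : LiftData EB F E} {p : TotalSpace F E}
    {N : EB × F → EB →L[ℝ] F}
    (hN : ∀ᶠ q in 𝓝 p, h.HasCoeffAt p q (N (extChartAt 𝓘T(EB, F) p q)))
    (hNd : DifferentiableAt ℝ N (extChartAt 𝓘T(EB, F) p p))
    {U : ∀ q : TotalSpace F E, TangentSpace 𝓘T(EB, F) q} {U' : EB × F → EB × F}
    (hU : ∀ᶠ q in 𝓝 p, chartDeriv 𝓘T(EB, F) p q (U q) = U' (extChartAt 𝓘T(EB, F) p q))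
    (hUd : DifferentiableAt ℝ U' (extChartAt 𝓘T(EB, F) p p))
    {σ : ∀ q : TotalSpace F E, E q.1} {s : EB × F → F}
    (hs : ∀ᶠ q in 𝓝 p, (trivializationAt F E p.1 ⟨q.1, σ q⟩).2 = s (extChartAt 𝓘T(EB, F) p q))
    (hsd : DifferentiableAt ℝ s (extChartAt 𝓘T(EB, F) p p)) :
    (trivializationAt F E p.1).linearMapAt ℝ p.1 (h.covDeriv U σ p)
      = fderiv ℝ s (extChartAt 𝓘T(EB, F) p p) (U' (extChartAt 𝓘T(EB, F) p p))
        - fderiv ℝ N (extChartAt 𝓘T(EB, F) p p) (0, s (extChartAt 𝓘T(EB, F) p p))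
          (U' (extChartAt 𝓘T(EB, F) p p)).1 := by
  have hm := mem_baseSet_trivializationAt F E p.1
  have hp := mem_extChartAt_source (I := 𝓘T(EB, F)) p
  have hY : ∀ᶠ q in 𝓝 p, chartDeriv 𝓘T(EB, F) p q (vLift EB q (σ q))
      = (0, s (extChartAt 𝓘T(EB, F) p q)) := by
    filter_upwards [hs, eventually_mem_extChartAt_source (I := 𝓘T(EB, F)) p] with q hq hq'
    have hb := (mem_bundleChart_source.1 hq').1
    rw [chartDeriv_vLift hq' (trivialization_vadd hb), ← hq, Trivialization.linearMapAt_apply,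
      if_pos hb]
  have h1 := LiftData.HasCoeffAt.mlieBracket_projH hN hNd hU hUd hY hsd
  -- The vector v with the expected coordinates is chosen beforehand, then recognized as the
  -- connector of the bracket.
  obtain ⟨v, hv⟩ := exists_linearMapAt_eq hm
    (fderiv ℝ s (extChartAt 𝓘T(EB, F) p p) ((U' (extChartAt 𝓘T(EB, F) p p)).1,
        N (extChartAt 𝓘T(EB, F) p p) (U' (extChartAt 𝓘T(EB, F) p p)).1)
      - fderiv ℝ N (extChartAt 𝓘T(EB, F) p p) (0, s (extChartAt 𝓘T(EB, F) p p))
        (U' (extChartAt 𝓘T(EB, F) p p)).1)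
  have h2 := hN.self_of_nhds.connector_eq hp (trivialization_vadd hm) (linearMapAt_injective hm)
    (hv.trans h1.symm)
  have h3 := hN.self_of_nhds.chartDeriv_projV (U p)
  have h4 : (chartDeriv 𝓘T(EB, F) p p (h.projV p (U p))).1 = 0 := by rw [h3]
  have h5 := chartDeriv_mfderiv_section hs hsd (h.projV p (U p))
  rw [LiftData.covDeriv, map_add, h2, hv,
    h.connector_eq_vLiftInv (W := E) (p := (⟨p.1, σ p⟩ : TotalSpace F E))
      (mem_extChartAt_source _) ((congrArg Prod.fst h5).trans h4),
    linearMapAt_vLiftInv_mfderiv_section hs hsd h4, h3, hU.self_of_nhds]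
  rw [sub_add_eq_add_sub, ← map_add]
  congr 2
  simp

end CovariantDerivative

/-! ### Differentiable coordinate expressions of smooth data -/

/-- For finite-dimensional E, an operator is the finite tuple of its values on a basis. Smoothness
of a connection directly controls N only through the vectors N v. -/
theorem differentiableAt_clm_of_apply {D E F : Type*} [NormedAddCommGroup D] [NormedSpace ℝ D]
    [NormedAddCommGroup E] [NormedSpace ℝ E] [NormedAddCommGroup F] [NormedSpace ℝ F]
    [FiniteDimensional ℝ E] {f : D → E →L[ℝ] F} {x : D}
    (h : ∀ v, DifferentiableAt ℝ (fun y => f y v) x) : DifferentiableAt ℝ f x := by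
  have hd : Module.finrank ℝ E = Module.finrank ℝ (Fin (Module.finrank ℝ E) → ℝ) :=
    (Module.finrank_fin_fun ℝ).symm
  let e₁ := ContinuousLinearEquiv.ofFinrankEq hd
  let e₂ := (e₁.arrowCongr (1 : F ≃L[ℝ] F)).trans
    (ContinuousLinearEquiv.piRing (Fin (Module.finrank ℝ E)))
  rw [← Function.id_comp f, ← e₂.symm_comp_self]
  exact e₂.symm.differentiableAt.comp x (differentiableAt_pi.2 fun i => h _)

section Coefficients

variable {M : Type*} [TopologicalSpace M]
  {EB : Type*} [NormedAddCommGroup EB] [NormedSpace ℝ EB] [ChartedSpace EB M]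
  {F : Type*} [NormedAddCommGroup F] [NormedSpace ℝ F]
  {P : M → Type*}
  [∀ m, TopologicalSpace (P m)] [TopologicalSpace (TotalSpace F P)] [FiberBundle F P]
  [IsManifold 𝓘(ℝ, EB) 1 M] [IsManifold 𝓘T(EB, F) 1 (TotalSpace F P)]

namespace LiftData

/-- The linear map `N` such that the horizontal projector at `q` is `(v, w) ↦ (v, N v)` in the chart
at `p`. -/
noncomputable def coeff (h : LiftData EB F P) (p q : TotalSpace F P) : EB →L[ℝ] F :=
  (ContinuousLinearMap.snd ℝ EB F).comp <| (chartDeriv 𝓘T(EB, F) p q).comp <|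
    (h.projH q).comp <| (chartDeriv 𝓘T(EB, F) p q).inverse.comp (ContinuousLinearMap.inl ℝ EB F)

variable {h : LiftData EB F P}

theorem chartDeriv_projH_fst {p q : TotalSpace F P}
    (hsplit : ∀ v : TangentSpace 𝓘(ℝ, EB) q.1, tangentProj EB q (h q v) = v)
    (hq : q ∈ (extChartAt 𝓘T(EB, F) p).source) (w : TangentSpace 𝓘T(EB, F) q) :
    (chartDeriv 𝓘T(EB, F) p q (h.projH q w)).1 = (chartDeriv 𝓘T(EB, F) p q w).1 := by
  rw [fst_chartDeriv hq, fst_chartDeriv hq, projH, ContinuousLinearMap.comp_apply, hsplit]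

/-- The projector factors through Tπ, so w may be replaced by the vector with coordinates (v, 0),
where v is the first coordinate of w. -/
theorem hasCoeffAt_coeff {p q : TotalSpace F P}
    (hsplit : ∀ v : TangentSpace 𝓘(ℝ, EB) q.1, tangentProj EB q (h q v) = v)
    (hq : q ∈ (extChartAt 𝓘T(EB, F) p).source) : h.HasCoeffAt p q (h.coeff p q) := by
  intro w
  refine Prod.ext (chartDeriv_projH_fst hsplit hq w) ?_
  have h1 : tangentProj EB q ((chartDeriv 𝓘T(EB, F) p q).inverse
      ((chartDeriv 𝓘T(EB, F) p q w).1, (0 : F))) = tangentProj EB q w := by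
    apply chartDeriv_injective (mem_bundleChart_source.1 hq).2
    rw [← fst_chartDeriv hq, ← fst_chartDeriv hq,
      (chartDeriv_isInvertible hq).self_apply_inverse]
  change _ = (chartDeriv 𝓘T(EB, F) p q (h q (tangentProj EB q
    ((chartDeriv 𝓘T(EB, F) p q).inverse ((chartDeriv 𝓘T(EB, F) p q w).1, (0 : F)))))).2
  rw [h1]
  rfl

/-- The local field with constant coordinates (v, 0) is smooth at p. The projector maps it to a
smooth field whose fibre coordinate is N v. -/
theorem differentiableAt_coeff [FiniteDimensional ℝ EB] {n : WithTop ℕ∞} (hn : n ≠ 0)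
    (hh : ContMDiff 𝓘T(EB, F).tangent 𝓘T(EB, F).tangent n
      (fun w : TangentBundle 𝓘T(EB, F) (TotalSpace F P) =>
        (⟨w.1, h.projH w.1 w.2⟩ : TangentBundle 𝓘T(EB, F) (TotalSpace F P))))
    (p : TotalSpace F P) :
    DifferentiableAt ℝ (fun x => h.coeff p ((extChartAt 𝓘T(EB, F) p).symm x))
      (extChartAt 𝓘T(EB, F) p p) := by
  refine differentiableAt_clm_of_apply fun v => ?_
  refine differentiableAt_comp_extChartAt_symm (f := fun q => h.coeff p q v) ?_
  have hX : ContMDiffAt 𝓘T(EB, F) 𝓘T(EB, F).tangent n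
      (fun q => (⟨q, (chartDeriv 𝓘T(EB, F) p q).inverse (v, (0 : F))⟩ :
        TangentBundle 𝓘T(EB, F) (TotalSpace F P))) p := by
    refine (contMDiffAt_section p).2 ((contMDiffAt_const (c := (v, (0 : F)))).congr_of_eventuallyEq ?_)
    filter_upwards [eventually_mem_extChartAt_source (I := 𝓘T(EB, F)) p] with q hq
    rw [trivializationAt_tangent_apply hq, (chartDeriv_isInvertible hq).self_apply_inverse]
  have hY := (contMDiffAt_section p).1 (hh.contMDiffAt.comp p hX)
  refine (differentiableAt_snd.mdifferentiableAt.comp p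
    (hY.mdifferentiableAt hn)).congr_of_eventuallyEq ?_
  filter_upwards [eventually_mem_extChartAt_source (I := 𝓘T(EB, F)) p] with q hq
  rw [Function.comp_apply, trivializationAt_tangent_apply hq]
  rfl

end LiftData

theorem exists_chartDeriv_field {n : WithTop ℕ∞} (hn : n ≠ 0) {p : TotalSpace F P}
    {U : ∀ q : TotalSpace F P, TangentSpace 𝓘T(EB, F) q}
    (hU : ContMDiffAt 𝓘T(EB, F) 𝓘T(EB, F).tangent n
      (fun q => (⟨q, U q⟩ : TangentBundle 𝓘T(EB, F) (TotalSpace F P))) p) :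
    ∃ U' : EB × F → EB × F, DifferentiableAt ℝ U' (extChartAt 𝓘T(EB, F) p p) ∧
      ∀ᶠ q in 𝓝 p, chartDeriv 𝓘T(EB, F) p q (U q) = U' (extChartAt 𝓘T(EB, F) p q) := by
  -- The witness, found by unification, is the component of U in the tangent trivialization at p,
  -- composed with the inverse chart.
  refine ⟨_, differentiableAt_comp_extChartAt_symm
    (((contMDiffAt_section p).1 hU).mdifferentiableAt hn), ?_⟩
  filter_upwards [eventually_mem_extChartAt_source (I := 𝓘T(EB, F)) p] with q hq
  rw [(extChartAt 𝓘T(EB, F) p).left_inv hq, trivializationAt_tangent_apply hq]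

theorem exists_section_coordinates {n : WithTop ℕ∞} (hn : n ≠ 0) {p : TotalSpace F P}
    {F' : Type*} [NormedAddCommGroup F'] [NormedSpace ℝ F'] {E : M → Type*}
    [∀ m, TopologicalSpace (E m)] [TopologicalSpace (TotalSpace F' E)] [FiberBundle F' E]
    {σ : ∀ q : TotalSpace F P, E q.1}
    (hσ : ContMDiffAt 𝓘T(EB, F) 𝓘T(EB, F') n
      (fun q => (⟨q.1, σ q⟩ : TotalSpace F' E)) p) :
    ∃ s : EB × F → F', DifferentiableAt ℝ s (extChartAt 𝓘T(EB, F) p p) ∧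
      ∀ᶠ q in 𝓝 p, (trivializationAt F' E p.1 ⟨q.1, σ q⟩).2 = s (extChartAt 𝓘T(EB, F) p q) := by
  refine ⟨_, differentiableAt_comp_extChartAt_symm
    ((contMDiffAt_totalSpace.1 hσ).2.mdifferentiableAt hn), ?_⟩
  filter_upwards [eventually_mem_extChartAt_source (I := 𝓘T(EB, F)) p] with q hq
  rw [(extChartAt 𝓘T(EB, F) p).left_inv hq]

end Coefficients

/-! ### Coordinates on Ã and the homogeneous extension -/

namespace AffineBundle

variable {M : Type*} [TopologicalSpace M]
  {EB : Type*} [NormedAddCommGroup EB] [NormedSpace ℝ EB] [ChartedSpace EB M]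
  {F : Type*} [NormedAddCommGroup F] [NormedSpace ℝ F] [FiniteDimensional ℝ F]
  {V : M → Type*} [∀ m, AddCommGroup (V m)] [∀ m, Module ℝ (V m)]
  [∀ m, TopologicalSpace (V m)] [TopologicalSpace (TotalSpace F V)] [FiberBundle F V]
  [VectorBundle ℝ F V]
  {A : M → Type*} [∀ m, AddTorsor (V m) (A m)]
  [∀ m, TopologicalSpace (A m)] [TopologicalSpace (TotalSpace F A)] [FiberBundle F A]
  [AffineBundle F V A]

/-- Both sides are linear in z, equal to 1 on `i₁` and to 0 on `i₀`, and these span. -/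
theorem spanCoord_fst {e : Trivialization F (π F A)}
    (he : e ∈ FiberBundle.trivializationAtlas F A) {m : M} (hm : m ∈ e.baseSet)
    (z : LinSpan (V m) (A m)) : (spanCoord V e m z).1 = LinSpan.j z := by
  have := finiteDimensional_fiber F V m
  obtain ⟨a⟩ := (inferInstance : Nonempty (A m))
  obtain ⟨v, hv⟩ := LinSpan.exists_eq_add a z
  conv_lhs => rw [hv]
  rw [map_add, map_smul, spanCoord_i₁ he hm, spanCoord_i₀ he hm]
  simp

variable {p q : TotalSpace F A} {z : TotalSpace (ℝ × F) (SpanBundle V A)}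

/-- The preferred trivialization of Ã is the one induced by that of A, with the same base set by
construction. -/
theorem mem_source_incl_iff :
    z ∈ (extChartAt 𝓘T(EB, ℝ × F) (incl F V A p)).source ↔
      z.1 ∈ (trivializationAt F A p.1).baseSet ∧ z.1 ∈ (extChartAt 𝓘(ℝ, EB) p.1).source :=
  mem_bundleChart_source

theorem incl_mem_source (hq : q ∈ (extChartAt 𝓘T(EB, F) p).source) :
    incl F V A q ∈ (extChartAt 𝓘T(EB, ℝ × F) (incl F V A p)).source :=
  mem_source_incl_iff.2 (mem_bundleChart_source.1 hq)

theorem base_mem_source (hz : z ∈ (extChartAt 𝓘T(EB, ℝ × F) (incl F V A p)).source) :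
    base z ∈ (extChartAt 𝓘T(EB, F) p).source :=
  (mem_bundleChart_source (q := base z)).2 (mem_source_incl_iff.1 hz)

theorem extChartAt_span (hz : z.1 ∈ (trivializationAt F A p.1).baseSet) :
    extChartAt 𝓘T(EB, ℝ × F) (incl F V A p) z
      = (extChartAt 𝓘(ℝ, EB) p.1 z.1, spanCoord V (trivializationAt F A p.1) z.1 z.2) :=
  bundleChart_apply (p := incl F V A p) hz

theorem extChartAt_incl (hq : q ∈ (extChartAt 𝓘T(EB, F) p).source) :
    extChartAt 𝓘T(EB, ℝ × F) (incl F V A p) (incl F V A q)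
      = ((extChartAt 𝓘T(EB, F) p q).1, (1, (extChartAt 𝓘T(EB, F) p q).2)) := by
  have hb := (mem_bundleChart_source.1 hq).1
  rw [extChartAt_span (z := incl F V A q) hb, bundleChart_apply hb]
  exact congrArg (Prod.mk _)
    (spanCoord_i₁ (FiberBundle.trivialization_mem_atlas' p.1) hb q.2)

theorem scale_mem_source (t : ℝ) (hz : z ∈ (extChartAt 𝓘T(EB, ℝ × F) (incl F V A p)).source) :
    scale (ℝ × F) (SpanBundle V A) t z ∈ (extChartAt 𝓘T(EB, ℝ × F) (incl F V A p)).source :=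
  mem_source_incl_iff.2 (mem_source_incl_iff.1 hz)

theorem extChartAt_scale (t : ℝ) (hz : z ∈ (extChartAt 𝓘T(EB, ℝ × F) (incl F V A p)).source) :
    extChartAt 𝓘T(EB, ℝ × F) (incl F V A p) (scale (ℝ × F) (SpanBundle V A) t z)
      = ((extChartAt 𝓘T(EB, ℝ × F) (incl F V A p) z).1,
        t • (extChartAt 𝓘T(EB, ℝ × F) (incl F V A p) z).2) := by
  have hb := (mem_source_incl_iff.1 hz).1
  rw [extChartAt_span hb, extChartAt_span (z := scale (ℝ × F) (SpanBundle V A) t z) hb]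
  exact congrArg (Prod.mk _) (map_smul (spanCoord V (trivializationAt F A p.1) z.1) t z.2)

theorem j_eq_extChartAt (hz : z ∈ (extChartAt 𝓘T(EB, ℝ × F) (incl F V A p)).source) :
    SpanBundle.j z.2 = (extChartAt 𝓘T(EB, ℝ × F) (incl F V A p) z).2.1 := by
  have hb := (mem_source_incl_iff.1 hz).1
  rw [extChartAt_span hb]
  exact (spanCoord_fst (FiberBundle.trivialization_mem_atlas' p.1) hb z.2).symm

/-- In coordinates, `base` is `(x, t, w) ↦ (x, w / t)`. -/
noncomputable def coordBase (x : EB × (ℝ × F)) : EB × F := (x.1, x.2.1⁻¹ • x.2.2)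

/-- In coordinates, the embedding of `A` into `Ã` is `(x, y) ↦ (x, 1, y)`. -/
noncomputable def coordIncl (x : EB × F) : EB × (ℝ × F) := (x.1, (1, x.2))

/-- Reading z = j(z) `base z` in coordinates gives (x, t, w) = (x, t · 1, t y), which is solved for
y. -/
theorem extChartAt_base (hz : z ∈ (extChartAt 𝓘T(EB, ℝ × F) (incl F V A p)).source)
    (hj : SpanBundle.j z.2 ≠ 0) :
    extChartAt 𝓘T(EB, F) p (base z)
      = coordBase (extChartAt 𝓘T(EB, ℝ × F) (incl F V A p) z) := by
  have h1 := extChartAt_scale (SpanBundle.j z.2) (incl_mem_source (base_mem_source hz))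
  rw [scale_incl_base z hj, extChartAt_incl (base_mem_source hz)] at h1
  rw [coordBase, h1]
  simp [hj]

/-- j is a continuous fibre coordinate near the point, and it equals 1 on A. -/
theorem eventually_j_ne_zero (p : TotalSpace F A) :
    ∀ᶠ z in 𝓝 (incl F V A p), SpanBundle.j z.2 ≠ 0 := by
  have hp := mem_baseSet_trivializationAt F A p.1
  have hc : ContinuousAt (fun z => (trivializationAt (ℝ × F) (SpanBundle V A) p.1 z).2.1)
      (incl F V A p) :=
    continuous_fst.continuousAt.comp (continuous_snd.continuousAt.comp
      ((trivializationAt (ℝ × F) (SpanBundle V A) p.1).continuousAt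
        (Trivialization.mem_source _ |>.2 hp)))
  have hb := (FiberBundle.continuous_proj (ℝ × F) (SpanBundle V A)).continuousAt.preimage_mem_nhds
    ((trivializationAt F A p.1).open_baseSet.mem_nhds (x := (incl F V A p).1) hp)
  have key : ∀ z : TotalSpace (ℝ × F) (SpanBundle V A), z.1 ∈ (trivializationAt F A p.1).baseSet →
      (trivializationAt (ℝ × F) (SpanBundle V A) p.1 z).2.1 = SpanBundle.j z.2 := fun z hz =>
    spanCoord_fst (FiberBundle.trivialization_mem_atlas' p.1) hz z.2
  have h1 : (trivializationAt (ℝ × F) (SpanBundle V A) p.1 (incl F V A p)).2.1 ≠ 0 := by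
    rw [key _ hp]
    exact one_ne_zero
  filter_upwards [hc.eventually_ne h1, hb] with z hz hz'
  rwa [key z hz'] at hz

@[simp] theorem coordBase_coordIncl (x : EB × F) : coordBase (coordIncl x) = x := by
  simp [coordBase, coordIncl]

/-- The derivative `(v, r, s) ↦ (v, s - r y)` of `coordBase` at `(x, 1, y)`. -/
noncomputable def coordBaseDeriv (y : F) : EB × (ℝ × F) →L[ℝ] EB × F :=
  (ContinuousLinearMap.fst ℝ EB (ℝ × F)).prod
    ((ContinuousLinearMap.snd ℝ ℝ F).comp (ContinuousLinearMap.snd ℝ EB (ℝ × F))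
      - ((ContinuousLinearMap.fst ℝ ℝ F).comp (ContinuousLinearMap.snd ℝ EB (ℝ × F))).smulRight y)

theorem hasFDerivAt_coordBase (x : EB × F) :
    HasFDerivAt (coordBase : EB × (ℝ × F) → EB × F) (coordBaseDeriv x.2) (coordIncl x) := by
  have h1 : HasFDerivAt (fun x : EB × (ℝ × F) => x.2.1) ((ContinuousLinearMap.fst ℝ ℝ F).comp
      (ContinuousLinearMap.snd ℝ EB (ℝ × F))) (coordIncl x) := hasFDerivAt_snd.fst
  have h2 : HasFDerivAt (fun x : EB × (ℝ × F) => x.2.2) ((ContinuousLinearMap.snd ℝ ℝ F).comp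
      (ContinuousLinearMap.snd ℝ EB (ℝ × F))) (coordIncl x) := hasFDerivAt_snd.snd
  have h3 := (hasDerivAt_inv (one_ne_zero (α := ℝ))).comp_hasFDerivAt_of_eq (coordIncl x) h1 rfl
  have h4 := (hasFDerivAt_fst (𝕜 := ℝ) (p := coordIncl x)).prodMk (h3.smul h2)
  refine h4.congr_fderiv ?_
  ext v <;> simp [coordBaseDeriv, coordIncl]

/-- `base` is defined by choice, so its continuity is read off from the formula (x, w/t). It
transports properties holding near p in A to properties holding near `incl F V A p` in Ã. -/
theorem tendsto_base (EB : Type*) [NormedAddCommGroup EB] [NormedSpace ℝ EB] [ChartedSpace EB M]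
    (p : TotalSpace F A) : Filter.Tendsto base (𝓝 (incl F V A p)) (𝓝 p) := by
  have hp := mem_extChartAt_source (I := 𝓘T(EB, F)) p
  have h0 := continuousAt_extChartAt (I := 𝓘T(EB, ℝ × F)) (incl F V A p)
  have h1 : ContinuousAt (fun z => coordBase (extChartAt 𝓘T(EB, ℝ × F) (incl F V A p) z))
      (incl F V A p) := by
    have hc := (hasFDerivAt_coordBase (extChartAt 𝓘T(EB, F) p p)).continuousAt
    exact ContinuousAt.comp_of_eq hc h0 (extChartAt_incl hp)
  have h2 : coordBase (extChartAt 𝓘T(EB, ℝ × F) (incl F V A p) (incl F V A p))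
      = extChartAt 𝓘T(EB, F) p p := by
    rw [extChartAt_incl hp]
    exact coordBase_coordIncl _
  have h3 := (continuousAt_extChartAt_symm (I := 𝓘T(EB, F)) p).tendsto
  rw [extChartAt_to_inv, ← h2] at h3
  refine (h3.comp h1.tendsto).congr' ?_
  filter_upwards [extChartAt_source_mem_nhds (I := 𝓘T(EB, ℝ × F)) (incl F V A p),
    eventually_j_ne_zero p] with z hz hj
  rw [Function.comp_apply, ← extChartAt_base hz hj]
  exact (extChartAt 𝓘T(EB, F) p).left_inv (base_mem_source hz)

variable [IsManifold 𝓘(ℝ, EB) 1 M] [IsManifold 𝓘T(EB, F) 1 (TotalSpace F A)]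
  [IsManifold 𝓘T(EB, ℝ × F) 1 (TotalSpace (ℝ × F) (SpanBundle V A))]

theorem hasFDerivAt_coordIncl (x : EB × F) :
    HasFDerivAt (coordIncl : EB × F → EB × (ℝ × F)) ((ContinuousLinearMap.fst ℝ EB F).prod
      ((0 : EB × F →L[ℝ] ℝ).prod (ContinuousLinearMap.snd ℝ EB F))) x :=
  hasFDerivAt_fst.prodMk ((hasFDerivAt_const _ _).prodMk hasFDerivAt_snd)

theorem mdifferentiableAt_incl (q : TotalSpace F A) :
    MDifferentiableAt 𝓘T(EB, F) 𝓘T(EB, ℝ × F) (incl F V A) q := by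
  have hev := eventually_mem_extChartAt_source (I := 𝓘T(EB, F)) q
  refine mdifferentiableAt_of_extChartAt (p := incl F V A q)
    (hev.mono fun y hy => incl_mem_source hy) ?_
  refine ((hasFDerivAt_coordIncl _).differentiableAt.mdifferentiableAt.comp q
    (mdifferentiableAt_extChartAt_of_mem (mem_extChartAt_source q))).congr_of_eventuallyEq ?_
  exact hev.mono fun y hy => extChartAt_incl hy

theorem chartDeriv_mfderiv_incl (hq : q ∈ (extChartAt 𝓘T(EB, F) p).source)
    (w : TangentSpace 𝓘T(EB, F) q) :
    chartDeriv 𝓘T(EB, ℝ × F) (incl F V A p) (incl F V A q)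
      (mfderiv 𝓘T(EB, F) 𝓘T(EB, ℝ × F) (incl F V A) q w)
      = ((chartDeriv 𝓘T(EB, F) p q w).1, (0, (chartDeriv 𝓘T(EB, F) p q w).2)) := by
  refine (chartDeriv_mfderiv (incl_mem_source hq) (mdifferentiableAt_incl q) w).trans ?_
  refine (mfderiv_eq_fderiv_chartDeriv (p := p) (g := coordIncl) hq ?_
    (hasFDerivAt_coordIncl _).differentiableAt w).trans ?_
  · exact (eventually_mem_bundleChart_source hq).mono fun y hy => extChartAt_incl hy
  · rw [(hasFDerivAt_coordIncl _).fderiv]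
    rfl

theorem chartDeriv_mfderiv_scale (t : ℝ)
    (hz : z ∈ (extChartAt 𝓘T(EB, ℝ × F) (incl F V A p)).source)
    (w : TangentSpace 𝓘T(EB, ℝ × F) z) :
    chartDeriv 𝓘T(EB, ℝ × F) (incl F V A p) (scale (ℝ × F) (SpanBundle V A) t z)
      (mfderiv 𝓘T(EB, ℝ × F) 𝓘T(EB, ℝ × F) (scale (ℝ × F) (SpanBundle V A) t) z w)
      = ((chartDeriv 𝓘T(EB, ℝ × F) (incl F V A p) z w).1,
        t • (chartDeriv 𝓘T(EB, ℝ × F) (incl F V A p) z w).2) := by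
  have hd : ∀ x : EB × (ℝ × F), HasFDerivAt (fun x : EB × (ℝ × F) => (x.1, t • x.2))
      ((ContinuousLinearMap.fst ℝ EB (ℝ × F)).prod
        (t • ContinuousLinearMap.snd ℝ EB (ℝ × F))) x := fun x =>
    hasFDerivAt_fst.prodMk (hasFDerivAt_snd.const_smul t)
  have hev := eventually_mem_bundleChart_source hz
  have hm : MDifferentiableAt 𝓘T(EB, ℝ × F) 𝓘T(EB, ℝ × F)
      (scale (ℝ × F) (SpanBundle V A) t) z := by
    refine mdifferentiableAt_of_extChartAt (p := incl F V A p)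
      (hev.mono fun y hy => scale_mem_source t hy) ?_
    refine ((hd _).differentiableAt.mdifferentiableAt.comp z
      (mdifferentiableAt_extChartAt_of_mem hz)).congr_of_eventuallyEq ?_
    exact hev.mono fun y hy => extChartAt_scale t hy
  refine (chartDeriv_mfderiv (scale_mem_source t hz) hm w).trans ?_
  refine (mfderiv_eq_fderiv_chartDeriv (p := incl F V A p)
    (g := fun x : EB × (ℝ × F) => (x.1, t • x.2)) hz ?_ (hd _).differentiableAt w).trans ?_
  · exact hev.mono fun y hy => extChartAt_scale t hy
  · rw [(hd _).fderiv]
    rfl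

/-- The scaling factor is frozen at t = j(z) when μ_t is differentiated, so the t-component stays 0
and the fibre component is multiplied by t. -/
theorem chartDeriv_homogeneousTangent
    (hz : z ∈ (extChartAt 𝓘T(EB, ℝ × F) (incl F V A p)).source) (hj : SpanBundle.j z.2 ≠ 0)
    (w : TangentSpace 𝓘T(EB, F) (base z)) :
    chartDeriv 𝓘T(EB, ℝ × F) (incl F V A p) z (homogeneousTangent z w)
      = ((chartDeriv 𝓘T(EB, F) p (base z) w).1,
        (0, SpanBundle.j z.2 • (chartDeriv 𝓘T(EB, F) p (base z) w).2)) := by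
  have hb := base_mem_source hz
  have h1 := chartDeriv_mfderiv_scale (SpanBundle.j z.2) (incl_mem_source (V := V) hb)
    (mfderiv 𝓘T(EB, F) 𝓘T(EB, ℝ × F) (incl F V A) (base z) w)
  rw [chartDeriv_mfderiv_incl hb] at h1
  -- Again the base point is only propositionally equal to z, and is generalized before
  -- substitution.
  have h2 : ∀ z', scale (ℝ × F) (SpanBundle V A) (SpanBundle.j z.2) (incl F V A (base z)) = z' →
      chartDeriv 𝓘T(EB, ℝ × F) (incl F V A p) z' (mfderiv 𝓘T(EB, ℝ × F) 𝓘T(EB, ℝ × F)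
        (scale (ℝ × F) (SpanBundle V A) (SpanBundle.j z.2)) (incl F V A (base z))
        (mfderiv 𝓘T(EB, F) 𝓘T(EB, ℝ × F) (incl F V A) (base z) w))
      = ((chartDeriv 𝓘T(EB, F) p (base z) w).1,
        (0, SpanBundle.j z.2 • (chartDeriv 𝓘T(EB, F) p (base z) w).2)) := by
    rintro _ rfl
    refine h1.trans ?_
    rw [Prod.smul_mk, smul_zero]
  exact h2 z (scale_incl_base z hj)

/-- The coefficients of the homogeneous extension of a connection with coefficients `N`. -/
noncomputable def homogeneousCoeff (N : EB × F → EB →L[ℝ] F) (x : EB × (ℝ × F)) : EB →L[ℝ] ℝ × F :=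
  (ContinuousLinearMap.inr ℝ ℝ F).comp (x.2.1 • N (coordBase x))

theorem hasCoeffAt_homogeneousLift {h : LiftData EB F A} {N : EB × F → EB →L[ℝ] F}
    (hz : z ∈ (extChartAt 𝓘T(EB, ℝ × F) (incl F V A p)).source) (hj : SpanBundle.j z.2 ≠ 0)
    (hsplit : ∀ v : TangentSpace 𝓘(ℝ, EB) (base z).1, tangentProj EB (base z) (h (base z) v) = v)
    (hN : h.HasCoeffAt p (base z) (N (extChartAt 𝓘T(EB, F) p (base z)))) :
    (homogeneousLift h).HasCoeffAt (incl F V A p) z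
      (homogeneousCoeff N (extChartAt 𝓘T(EB, ℝ × F) (incl F V A p) z)) := by
  intro w
  have hb := base_mem_source hz
  have h1 : ∀ v : TangentSpace 𝓘(ℝ, EB) (base z).1,
      chartDeriv 𝓘T(EB, F) p (base z) (h (base z) v)
        = (chartDeriv 𝓘(ℝ, EB) p.1 (base z).1 v,
          N (extChartAt 𝓘T(EB, F) p (base z)) (chartDeriv 𝓘(ℝ, EB) p.1 (base z).1 v)) := by
    intro v
    have h2 := hN (h (base z) v)
    rwa [LiftData.projH, ContinuousLinearMap.comp_apply, hsplit, fst_chartDeriv hb, hsplit] at h2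
  refine (chartDeriv_homogeneousTangent hz hj (h (base z) (tangentProj EB z w))).trans ?_
  have h2 := fst_chartDeriv hz w
  rw [h2, homogeneousCoeff, ← extChartAt_base hz hj, ← j_eq_extChartAt hz, h1 (tangentProj EB z w)]
  rfl

end AffineBundle

/-! ### Independence of the extensions -/

namespace AffineBundle

variable {M : Type*} [TopologicalSpace M]
  {EB : Type*} [NormedAddCommGroup EB] [NormedSpace ℝ EB] [ChartedSpace EB M]
  {F : Type*} [NormedAddCommGroup F] [NormedSpace ℝ F] [FiniteDimensional ℝ F]
  {V : M → Type*} [∀ m, AddCommGroup (V m)] [∀ m, Module ℝ (V m)]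
  [∀ m, TopologicalSpace (V m)] [TopologicalSpace (TotalSpace F V)] [FiberBundle F V]
  [VectorBundle ℝ F V]
  {A : M → Type*} [∀ m, AddTorsor (V m) (A m)]
  [∀ m, TopologicalSpace (A m)] [TopologicalSpace (TotalSpace F A)] [FiberBundle F A]
  [AffineBundle F V A]

/-- Product and chain rule for t N(x, w/t) at t = 1. The direction (v, r, w) gives dN(v, w − r y) +
r N, placed in the F-component of ℝ × F. -/
theorem hasFDerivAt_homogeneousCoeff {N : EB × F → EB →L[ℝ] F} {x : EB × F}
    (hN : DifferentiableAt ℝ N x) :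
    HasFDerivAt (homogeneousCoeff N) ((ContinuousLinearMap.compL ℝ EB F (ℝ × F)
      (ContinuousLinearMap.inr ℝ ℝ F)).comp ((fderiv ℝ N x).comp (coordBaseDeriv x.2)
      + ((ContinuousLinearMap.fst ℝ ℝ F).comp
        (ContinuousLinearMap.snd ℝ EB (ℝ × F))).smulRight (N x))) (coordIncl x) := by
  have h1 : HasFDerivAt (fun x : EB × (ℝ × F) => x.2.1) ((ContinuousLinearMap.fst ℝ ℝ F).comp
      (ContinuousLinearMap.snd ℝ EB (ℝ × F))) (coordIncl x) := hasFDerivAt_snd.fst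
  have hN' : HasFDerivAt N (fderiv ℝ N x) (coordBase (coordIncl x)) := by
    rw [coordBase_coordIncl]
    exact hN.hasFDerivAt
  have h2 := hN'.comp (coordIncl x) (hasFDerivAt_coordBase x)
  have h3 := (ContinuousLinearMap.compL ℝ EB F (ℝ × F)
      (ContinuousLinearMap.inr ℝ ℝ F)).hasFDerivAt.comp (coordIncl x) (h1.smul h2)
  refine h3.congr_fderiv ?_
  congr 1
  rw [Function.comp_apply, coordBase_coordIncl]
  congr 1
  exact one_smul ℝ _

variable [IsManifold 𝓘(ℝ, EB) 1 M] [IsManifold 𝓘T(EB, F) 1 (TotalSpace F A)]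
  [IsManifold 𝓘T(EB, ℝ × F) 1 (TotalSpace (ℝ × F) (SpanBundle V A))]

/-- The linearization in coordinates depends on the restrictions to `A` only. -/
theorem linearMapAt_covDeriv_of_extension {h : LiftData EB F A} {p : TotalSpace F A}
    (hsplit : ∀ (q : TotalSpace F A) (v : TangentSpace 𝓘(ℝ, EB) q.1), tangentProj EB q (h q v) = v)
    {N : EB × F → EB →L[ℝ] F}
    (hN : ∀ᶠ q in 𝓝 p, h.HasCoeffAt p q (N (extChartAt 𝓘T(EB, F) p q)))
    (hNd : DifferentiableAt ℝ N (extChartAt 𝓘T(EB, F) p p))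
    {σ : ∀ q : TotalSpace F A, SpanBundle V A q.1} {s : EB × F → ℝ × F}
    (hs : ∀ᶠ q in 𝓝 p, (trivializationAt (ℝ × F) (SpanBundle V A) p.1 ⟨q.1, σ q⟩).2
      = s (extChartAt 𝓘T(EB, F) p q))
    {X : TangentSpace 𝓘T(EB, F) p}
    {U' : ∀ z : TotalSpace (ℝ × F) (SpanBundle V A), TangentSpace 𝓘T(EB, ℝ × F) z}
    (hUX : U' (incl F V A p) = mfderiv 𝓘T(EB, F) 𝓘T(EB, ℝ × F) (incl F V A) p X)
    {u : EB × (ℝ × F) → EB × (ℝ × F)}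
    (hU : ∀ᶠ z in 𝓝 (incl F V A p), chartDeriv 𝓘T(EB, ℝ × F) (incl F V A p) z (U' z)
      = u (extChartAt 𝓘T(EB, ℝ × F) (incl F V A p) z))
    (hUd : DifferentiableAt ℝ u (extChartAt 𝓘T(EB, ℝ × F) (incl F V A p) (incl F V A p)))
    {σ' : ∀ z : TotalSpace (ℝ × F) (SpanBundle V A), SpanBundle V A z.1}
    (hσ : ∀ q : TotalSpace F A, σ' (incl F V A q) = σ q) {s' : EB × (ℝ × F) → ℝ × F}
    (hs' : ∀ᶠ z in 𝓝 (incl F V A p), (trivializationAt (ℝ × F) (SpanBundle V A)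
      (incl F V A p).1 ⟨z.1, σ' z⟩).2 = s' (extChartAt 𝓘T(EB, ℝ × F) (incl F V A p) z))
    (hsd' : DifferentiableAt ℝ s' (extChartAt 𝓘T(EB, ℝ × F) (incl F V A p) (incl F V A p))) :
    (trivializationAt (ℝ × F) (SpanBundle V A) p.1).linearMapAt ℝ p.1
        ((homogeneousLift h).covDeriv U' σ' (incl F V A p))
      = fderiv ℝ s (extChartAt 𝓘T(EB, F) p p) (chartDeriv 𝓘T(EB, F) p p X)
        - fderiv ℝ (homogeneousCoeff N) (coordIncl (extChartAt 𝓘T(EB, F) p p))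
          (0, s (extChartAt 𝓘T(EB, F) p p)) (chartDeriv 𝓘T(EB, F) p p X).1 := by
  have hp := mem_extChartAt_source (I := 𝓘T(EB, F)) p
  have hΦ : extChartAt 𝓘T(EB, ℝ × F) (incl F V A p) (incl F V A p)
      = coordIncl (extChartAt 𝓘T(EB, F) p p) := extChartAt_incl hp
  have hN' : ∀ᶠ z in 𝓝 (incl F V A p), (homogeneousLift h).HasCoeffAt (incl F V A p) z
      (homogeneousCoeff N (extChartAt 𝓘T(EB, ℝ × F) (incl F V A p) z)) := by
    filter_upwards [eventually_mem_extChartAt_source (I := 𝓘T(EB, ℝ × F)) (incl F V A p),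
      eventually_j_ne_zero p, (tendsto_base EB p).eventually hN] with z hz hj hb
    exact hasCoeffAt_homogeneousLift hz hj (hsplit _) hb
  -- The value of U' is tangent to A, so its t-component is 0 and it lies in the image of the
  -- derivative of `coordIncl`.
  have hX : u (coordIncl (extChartAt 𝓘T(EB, F) p p)) = ((chartDeriv 𝓘T(EB, F) p p X).1,
      (0, (chartDeriv 𝓘T(EB, F) p p X).2)) := by
    rw [← hΦ, ← hU.self_of_nhds, hUX, chartDeriv_mfderiv_incl hp]
  have hss : ∀ᶠ q in 𝓝 p, s (extChartAt 𝓘T(EB, F) p q)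
      = s' (coordIncl (extChartAt 𝓘T(EB, F) p q)) := by
    filter_upwards [hs, (mdifferentiableAt_incl (EB := EB) (V := V) p).continuousAt.eventually hs',
      eventually_mem_extChartAt_source (I := 𝓘T(EB, F)) p] with q h1 h2 h3
    rw [← h1, coordIncl, ← extChartAt_incl h3, ← h2, hσ]
    rfl
  -- Since σ' extends σ along A, ds' in a direction tangent to A equals ds by the chain rule. The
  -- values of σ' off A do not enter.
  have hss' : s =ᶠ[𝓝 (extChartAt 𝓘T(EB, F) p p)] s' ∘ coordIncl := by
    have hc := (continuousAt_extChartAt_symm (I := 𝓘T(EB, F)) p).tendsto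
    rw [extChartAt_to_inv] at hc
    filter_upwards [hc.eventually hss, extChartAt_target_mem_nhds (I := 𝓘T(EB, F)) p] with x h1 h2
    rwa [(extChartAt 𝓘T(EB, F) p).right_inv h2] at h1
  have key := LiftData.HasCoeffAt.linearMapAt_covDeriv hN'
    (by rw [hΦ]; exact (hasFDerivAt_homogeneousCoeff hNd).differentiableAt) hU hUd hs' hsd'
  rw [hΦ, hX] at key
  rw [hΦ] at hsd'
  have hd := hsd'.hasFDerivAt.comp _ (hasFDerivAt_coordIncl (extChartAt 𝓘T(EB, F) p p))
  refine key.trans ?_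
  rw [hss'.fderiv_eq, hd.fderiv, hss'.self_of_nhds]
  rfl

theorem homogeneousField_incl {p : TotalSpace F A}
    (U : ∀ q : TotalSpace F A, TangentSpace 𝓘T(EB, F) q) {u : EB × F → EB × F}
    (hU : ∀ᶠ q in 𝓝 p, chartDeriv 𝓘T(EB, F) p q (U q) = u (extChartAt 𝓘T(EB, F) p q)) :
    ∀ᶠ z in 𝓝 (incl F V A p), chartDeriv 𝓘T(EB, ℝ × F) (incl F V A p) z (homogeneousField U z)
      = (fun x : EB × (ℝ × F) => ((u (coordBase x)).1, (0, x.2.1 • (u (coordBase x)).2)))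
        (extChartAt 𝓘T(EB, ℝ × F) (incl F V A p) z) := by
  filter_upwards [eventually_mem_extChartAt_source (I := 𝓘T(EB, ℝ × F)) (incl F V A p),
    eventually_j_ne_zero p, (tendsto_base EB p).eventually hU] with z hz hj hb
  rw [homogeneousField, chartDeriv_homogeneousTangent hz hj, hb, extChartAt_base hz hj,
    j_eq_extChartAt hz]

/-- The point chosen by `base` has the same coordinates as p, and charts are injective. EB serves
only to provide the chart. -/
theorem base_incl (EB : Type*) [NormedAddCommGroup EB] [NormedSpace ℝ EB] [ChartedSpace EB M]
    (p : TotalSpace F A) : base (incl F V A p) = p := by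
  have hp := mem_extChartAt_source (I := 𝓘T(EB, F)) p
  have h1 := extChartAt_base (incl_mem_source (V := V) hp) (one_ne_zero : (1 : ℝ) ≠ 0)
  rw [extChartAt_incl hp] at h1
  exact (extChartAt 𝓘T(EB, F) p).injOn (base_mem_source (incl_mem_source hp)) hp
    (h1.trans (coordBase_coordIncl _))

theorem extendSection_incl (EB : Type*) [NormedAddCommGroup EB] [NormedSpace ℝ EB]
    [ChartedSpace EB M] (σ : ∀ q : TotalSpace F A, SpanBundle V A q.1) (p : TotalSpace F A) :
    extendSection σ (incl F V A p) = σ p := by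
  -- σ is dependent, so an equality of points cannot be rewritten directly. Here the base points
  -- agree definitionally, and the transport becomes trivial with `rfl`.
  have h : ∀ (q : TotalSpace F A) (hq : q.1 = p.1), q = p → hq ▸ σ q = σ p := by
    rintro _ hq rfl
    rfl
  exact h (base (incl F V A p)) rfl (base_incl EB p)

end AffineBundle

/-! ### Both sides of the formula in coordinates -/

namespace AffineBundle

variable {M : Type*} [TopologicalSpace M]
  {EB : Type*} [NormedAddCommGroup EB] [NormedSpace ℝ EB] [ChartedSpace EB M]
  {F : Type*} [NormedAddCommGroup F] [NormedSpace ℝ F] [FiniteDimensional ℝ F]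
  {V : M → Type*} [∀ m, AddCommGroup (V m)] [∀ m, Module ℝ (V m)]
  [∀ m, TopologicalSpace (V m)] [TopologicalSpace (TotalSpace F V)] [FiberBundle F V]
  [VectorBundle ℝ F V]
  {A : M → Type*} [∀ m, AddTorsor (V m) (A m)]
  [∀ m, TopologicalSpace (A m)] [TopologicalSpace (TotalSpace F A)] [FiberBundle F A]
  [AffineBundle F V A]
  [IsManifold 𝓘(ℝ, EB) 1 M] [IsManifold 𝓘T(EB, F) 1 (TotalSpace F A)]
  [IsManifold 𝓘T(EB, ℝ × F) 1 (TotalSpace (ℝ × F) (SpanBundle V A))]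

theorem homogeneousField_incl_eq {p : TotalSpace F A}
    (U : ∀ q : TotalSpace F A, TangentSpace 𝓘T(EB, F) q) {u : EB × F → EB × F}
    (hU : ∀ᶠ q in 𝓝 p, chartDeriv 𝓘T(EB, F) p q (U q) = u (extChartAt 𝓘T(EB, F) p q)) :
    homogeneousField U (incl F V A p)
      = mfderiv 𝓘T(EB, F) 𝓘T(EB, ℝ × F) (incl F V A) p (U p) := by
  have hp := mem_extChartAt_source (I := 𝓘T(EB, F)) p
  apply chartDeriv_injective (mem_extChartAt_source (I := 𝓘T(EB, ℝ × F)) (incl F V A p))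
  rw [chartDeriv_mfderiv_incl hp, (homogeneousField_incl U hU).self_of_nhds, extChartAt_incl hp,
    hU.self_of_nhds]
  change ((u (coordBase (coordIncl (extChartAt 𝓘T(EB, F) p p)))).1, ((0 : ℝ),
    (1 : ℝ) • (u (coordBase (coordIncl (extChartAt 𝓘T(EB, F) p p)))).2)) = _
  rw [coordBase_coordIncl, one_smul]

/-- The extensions used to define the linearization are themselves differentiable extensions near A,
with coordinates obtained through `coordBase`. The general computation applies to them. -/
theorem linearMapAt_covDeriv_homogeneous {h : LiftData EB F A} {p : TotalSpace F A}
    (hsplit : ∀ (q : TotalSpace F A) (v : TangentSpace 𝓘(ℝ, EB) q.1), tangentProj EB q (h q v) = v)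
    {N : EB × F → EB →L[ℝ] F}
    (hN : ∀ᶠ q in 𝓝 p, h.HasCoeffAt p q (N (extChartAt 𝓘T(EB, F) p q)))
    (hNd : DifferentiableAt ℝ N (extChartAt 𝓘T(EB, F) p p))
    {σ : ∀ q : TotalSpace F A, SpanBundle V A q.1} {s : EB × F → ℝ × F}
    (hs : ∀ᶠ q in 𝓝 p, (trivializationAt (ℝ × F) (SpanBundle V A) p.1 ⟨q.1, σ q⟩).2
      = s (extChartAt 𝓘T(EB, F) p q))
    (hsd : DifferentiableAt ℝ s (extChartAt 𝓘T(EB, F) p p))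
    {U : ∀ q : TotalSpace F A, TangentSpace 𝓘T(EB, F) q} {u : EB × F → EB × F}
    (hU : ∀ᶠ q in 𝓝 p, chartDeriv 𝓘T(EB, F) p q (U q) = u (extChartAt 𝓘T(EB, F) p q))
    (hUd : DifferentiableAt ℝ u (extChartAt 𝓘T(EB, F) p p)) :
    (trivializationAt (ℝ × F) (SpanBundle V A) p.1).linearMapAt ℝ p.1
        ((homogeneousLift h).covDeriv (homogeneousField U) (extendSection σ) (incl F V A p))
      = fderiv ℝ s (extChartAt 𝓘T(EB, F) p p) (chartDeriv 𝓘T(EB, F) p p (U p))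
        - fderiv ℝ (homogeneousCoeff N) (coordIncl (extChartAt 𝓘T(EB, F) p p))
          (0, s (extChartAt 𝓘T(EB, F) p p)) (chartDeriv 𝓘T(EB, F) p p (U p)).1 := by
  have hp := mem_extChartAt_source (I := 𝓘T(EB, F)) p
  have hΦ : extChartAt 𝓘T(EB, ℝ × F) (incl F V A p) (incl F V A p)
      = coordIncl (extChartAt 𝓘T(EB, F) p p) := extChartAt_incl hp
  have hB := (hasFDerivAt_coordBase (extChartAt 𝓘T(EB, F) p p)).differentiableAt
  rw [← coordBase_coordIncl (extChartAt 𝓘T(EB, F) p p)] at hUd hsd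
  have hud := hUd.comp (coordIncl (extChartAt 𝓘T(EB, F) p p)) hB
  refine linearMapAt_covDeriv_of_extension hsplit hN hNd hs (homogeneousField_incl_eq U hU)
    (u := fun x : EB × (ℝ × F) => ((u (coordBase x)).1, (0, x.2.1 • (u (coordBase x)).2)))
    (homogeneousField_incl U hU) ?_ (extendSection_incl EB σ) (s' := s ∘ coordBase) ?_ ?_
  · rw [hΦ]
    exact hud.fst.prodMk ((differentiableAt_const _).prodMk
      (differentiableAt_snd.fst.smul hud.snd))
  · filter_upwards [eventually_mem_extChartAt_source (I := 𝓘T(EB, ℝ × F)) (incl F V A p),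
      eventually_j_ne_zero p, (tendsto_base EB p).eventually hs] with z hz hj hb
    rw [Function.comp_apply, ← extChartAt_base hz hj, ← hb]
    rfl
  · rw [hΦ]
    exact hsd.comp _ hB

/-- The linearization in terms of vector fields on `A`, in coordinates. -/
theorem linearMapAt_linearization_formula {h : LiftData EB F A} {p : TotalSpace F A}
    {N : EB × F → EB →L[ℝ] F}
    (hN : ∀ᶠ q in 𝓝 p, h.HasCoeffAt p q (N (extChartAt 𝓘T(EB, F) p q)))
    (hNd : DifferentiableAt ℝ N (extChartAt 𝓘T(EB, F) p p))
    {σ : ∀ q : TotalSpace F A, SpanBundle V A q.1} {s : EB × F → ℝ × F}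
    (hs : ∀ᶠ q in 𝓝 p, (trivializationAt (ℝ × F) (SpanBundle V A) p.1 ⟨q.1, σ q⟩).2
      = s (extChartAt 𝓘T(EB, F) p q))
    (hsd : DifferentiableAt ℝ s (extChartAt 𝓘T(EB, F) p p))
    {U : ∀ q : TotalSpace F A, TangentSpace 𝓘T(EB, F) q} {u : EB × F → EB × F}
    (hU : ∀ᶠ q in 𝓝 p, chartDeriv 𝓘T(EB, F) p q (U q) = u (extChartAt 𝓘T(EB, F) p q))
    (hUd : DifferentiableAt ℝ u (extChartAt 𝓘T(EB, F) p p)) :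
    (trivializationAt (ℝ × F) (SpanBundle V A) p.1).linearMapAt ℝ p.1
      (SpanBundle.i₀ (h.connector p
          (VectorField.mlieBracket 𝓘T(EB, F) (fun q => h.projH q (U q))
            (fun q => vLift EB q (bar σ q)) p))
        + vLiftInv EB (⟨p.1, σ p⟩ : TotalSpace (ℝ × F) (SpanBundle V A))
            (mfderiv 𝓘T(EB, F) 𝓘T(EB, ℝ × F)
              (fun q => (⟨q.1, σ q⟩ : TotalSpace (ℝ × F) (SpanBundle V A))) p
              (h.projV p (U p)))
        + tangentDeriv (h.projH p (U p)) (fun q => SpanBundle.j (σ q)) • SpanBundle.i₁ p.2)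
      = fderiv ℝ s (extChartAt 𝓘T(EB, F) p p) (chartDeriv 𝓘T(EB, F) p p (U p))
        - fderiv ℝ (homogeneousCoeff N) (coordIncl (extChartAt 𝓘T(EB, F) p p))
          (0, s (extChartAt 𝓘T(EB, F) p p)) (chartDeriv 𝓘T(EB, F) p p (U p)).1 := by
  have hp := mem_extChartAt_source (I := 𝓘T(EB, F)) p
  have hm := mem_baseSet_trivializationAt F A p.1
  have he := FiberBundle.trivialization_mem_atlas' (F := F) (E := A) p.1
  have hlin : ∀ z : SpanBundle V A p.1,
      (trivializationAt (ℝ × F) (SpanBundle V A) p.1).linearMapAt ℝ p.1 z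
        = spanCoord V (trivializationAt F A p.1) p.1 z := fun z => by
    rw [Trivialization.linearMapAt_apply, if_pos (mem_baseSet_trivializationAt _ _ _)]
    rfl
  have hvadd : ∀ {m : M} (hm : m ∈ (trivializationAt F A p.1).baseSet) (v : V m) (a : A m),
      (trivializationAt F A p.1 ⟨m, v +ᵥ a⟩).2
        = (fiberEquiv V he hm).linear v + (trivializationAt F A p.1 ⟨m, a⟩).2 := by
    intro m hm v a
    have h1 := AffineEquiv.map_vadd (fiberEquiv V he hm) a v
    rwa [fiberEquiv_apply, fiberEquiv_apply] at h1
  set x := extChartAt 𝓘T(EB, F) p p with hx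
  -- The coordinate of σ̄: since 𝕀 reads (1, y), s − s₁ (1, y) = (0, s₂ − s₁ y).
  set t : EB × F → F := fun x => (s x).2 - (s x).1 • x.2 with ht
  have htd : HasFDerivAt t ((ContinuousLinearMap.snd ℝ ℝ F).comp (fderiv ℝ s x)
      - ((s x).1 • ContinuousLinearMap.snd ℝ EB F
        + ((ContinuousLinearMap.fst ℝ ℝ F).comp (fderiv ℝ s x)).smulRight x.2)) x :=
    hsd.hasFDerivAt.snd.sub (hsd.hasFDerivAt.fst.smul hasFDerivAt_snd)
  have hY : ∀ᶠ q in 𝓝 p, chartDeriv 𝓘T(EB, F) p q (vLift EB q (bar σ q))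
      = (0, t (extChartAt 𝓘T(EB, F) p q)) := by
    filter_upwards [hs, eventually_mem_extChartAt_source (I := 𝓘T(EB, F)) p] with q h1 h2
    have hb := (mem_bundleChart_source.1 h2).1
    rw [chartDeriv_vLift h2 (L := (fiberEquiv V he hb).linear) (hvadd hb)]
    refine congrArg (Prod.mk (0 : EB)) ?_
    have h3 := congrArg (spanCoord V (trivializationAt F A p.1) q.1) (i₀_bar σ q)
    have h4 := (spanCoord_i₀ he hb (bar σ q)).symm.trans h3
    have h5 : spanCoord V (trivializationAt F A p.1) q.1 (σ q) = s (extChartAt 𝓘T(EB, F) p q) := h1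
    have h6 : SpanBundle.j (σ q) = (s (extChartAt 𝓘T(EB, F) p q)).1 := by
      rw [← h5]
      exact (spanCoord_fst he hb (σ q)).symm
    have h7 : spanCoord V (trivializationAt F A p.1) q.1
        (σ q - SpanBundle.j (σ q) • (SpanBundle.i₁ q.2 : SpanBundle V A q.1))
        = s (extChartAt 𝓘T(EB, F) p q)
          - SpanBundle.j (σ q) • ((1 : ℝ), (trivializationAt F A p.1 q).2) := by
      refine (map_sub _ _ _).trans ?_
      rw [h5]
      congr 1
      refine (map_smul _ _ _).trans ?_
      congr 1
      exact spanCoord_i₁ he hb q.2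
    refine (congrArg Prod.snd (h4.trans h7)).trans ?_
    rw [h6, ht, bundleChart_apply hb]
    rfl
  have hbr := LiftData.HasCoeffAt.mlieBracket_projH hN hNd hU hUd hY htd.differentiableAt
  obtain ⟨v, hv⟩ := (fiberEquiv V he hm).linear.surjective
    (fderiv ℝ t x ((u x).1, N x (u x).1) - fderiv ℝ N x (0, t x) (u x).1)
  have hconn := hN.self_of_nhds.connector_eq hp (L := (fiberEquiv V he hm).linear) (hvadd hm)
    (fiberEquiv V he hm).linear.injective (hv.trans hbr.symm)
  have hV := hN.self_of_nhds.chartDeriv_projV (U p)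
  have hvert := linearMapAt_vLiftInv_mfderiv_section (w := h.projV p (U p)) hs hsd
    (congrArg Prod.fst hV)
  have hder : tangentDeriv (h.projH p (U p)) (fun q => SpanBundle.j (σ q))
      = (fderiv ℝ s x ((u x).1, N x (u x).1)).1 := by
    refine (mfderiv_eq_fderiv_chartDeriv (p := p) (g := fun x => (s x).1) hp ?_
      hsd.hasFDerivAt.fst.differentiableAt _).trans ?_
    · filter_upwards [hs, eventually_mem_extChartAt_source (I := 𝓘T(EB, F)) p] with q h1 h2
      rw [← h1]
      exact (spanCoord_fst he (mem_bundleChart_source.1 h2).1 (σ q)).symm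
    · rw [hsd.hasFDerivAt.fst.fderiv, hN.self_of_nhds, hU.self_of_nhds]
      rfl
  have hi₀ : (trivializationAt (ℝ × F) (SpanBundle V A) p.1).linearMapAt ℝ p.1
      (SpanBundle.i₀ v) = (0, (fiberEquiv V he hm).linear v) :=
    (hlin _).trans (spanCoord_i₀ he hm v)
  have hi₁ : (trivializationAt (ℝ × F) (SpanBundle V A) p.1).linearMapAt ℝ p.1
      (SpanBundle.i₁ p.2) = (1, x.2) := by
    refine (hlin _).trans ((spanCoord_i₁ he hm p.2).trans ?_)
    rw [hx, bundleChart_apply hm]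
  rw [map_add, map_add, map_smul, hconn, hder, hvert, hi₀, hi₁, hv, hV, hU.self_of_nhds,
    (hasFDerivAt_homogeneousCoeff hNd).fderiv, htd.fderiv]
  -- Splitting u into its horizontal and vertical parts separates the horizontal derivative of s,
  -- shared by the bracket and the 𝕀 term, from the term Tσ(P_V(U)).
  have hsplit : fderiv ℝ s x (u x) = fderiv ℝ s x ((u x).1, N x (u x).1)
      + fderiv ℝ s x (0, (u x).2 - N x (u x).1) := by
    rw [← map_add]
    congr 1
    simp
  simp only [← hx]
  rw [hsplit]
  refine Prod.ext ?_ ?_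
  · simp [coordBaseDeriv, add_comm]
  -- In the F-component, −ds₁(u₁, N u₁) y from dt cancels against the 𝕀 term, and −s₁ N u₁ matches
  -- the r N part of the derivative of the extended coefficients.
  · simp only [ht, coordBaseDeriv, ContinuousLinearMap.comp_apply, add_apply,
      sub_apply, smul_apply, ContinuousLinearMap.smulRight_apply,
      ContinuousLinearMap.prod_apply, ContinuousLinearMap.compL_apply,
      ContinuousLinearMap.coe_fst', ContinuousLinearMap.coe_snd', ContinuousLinearMap.inr_apply,
      Prod.snd_add, Prod.snd_sub, Prod.smul_snd]
    abel

end AffineBundle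

/-! ### The theorem -/

theorem mainTheorem8
    {EB : Type*} [NormedAddCommGroup EB] [NormedSpace ℝ EB] [FiniteDimensional ℝ EB]
    {M : Type*} [TopologicalSpace M] [ChartedSpace EB M] [IsManifold 𝓘(ℝ, EB) ∞ M]
    {F : Type*} [NormedAddCommGroup F] [NormedSpace ℝ F] [FiniteDimensional ℝ F]
    {V : M → Type*} [∀ m, AddCommGroup (V m)] [∀ m, Module ℝ (V m)]
    [∀ m, TopologicalSpace (V m)] [TopologicalSpace (TotalSpace F V)] [FiberBundle F V]
    [VectorBundle ℝ F V] [ContMDiffVectorBundle ∞ F V 𝓘(ℝ, EB)]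
    {A : M → Type*} [∀ m, AddTorsor (V m) (A m)]
    [∀ m, TopologicalSpace (A m)] [TopologicalSpace (TotalSpace F A)] [FiberBundle F A]
    [AffineBundle F V A] [ContMDiffAffineBundle ∞ 𝓘(ℝ, EB) F V A]
    (c : AffineBundle.Connection EB F V A)
    (U : ∀ p : TotalSpace F A, TangentSpace 𝓘T(EB, F) p)
    (hU : AffineBundle.IsSmoothVectorField U)
    (σ : ∀ p : TotalSpace F A, SpanBundle V A p.1)
    (hσ : ContMDiff 𝓘T(EB, F) 𝓘T(EB, ℝ × F) ∞
      (fun p => (⟨p.1, σ p⟩ : TotalSpace (ℝ × F) (SpanBundle V A)))) :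
    (∀ (U' : ∀ z : TotalSpace (ℝ × F) (SpanBundle V A), TangentSpace 𝓘T(EB, ℝ × F) z)
      (σ' : ∀ z : TotalSpace (ℝ × F) (SpanBundle V A), SpanBundle V A z.1),
      ContMDiffOn 𝓘T(EB, ℝ × F) 𝓘T(EB, ℝ × F).tangent ∞
        (fun z => (⟨z, U' z⟩ : TangentBundle 𝓘T(EB, ℝ × F) (TotalSpace (ℝ × F) (SpanBundle V A))))
        {z | SpanBundle.j z.2 ≠ 0} →
      ContMDiffOn 𝓘T(EB, ℝ × F) 𝓘T(EB, ℝ × F) ∞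
        (fun z => (⟨z.1, σ' z⟩ : TotalSpace (ℝ × F) (SpanBundle V A)))
        {z | SpanBundle.j z.2 ≠ 0} →
      (∀ p : TotalSpace F A, U' (AffineBundle.incl F V A p) =
        mfderiv 𝓘T(EB, F) 𝓘T(EB, ℝ × F) (AffineBundle.incl F V A) p (U p)) →
      (∀ p : TotalSpace F A, σ' (AffineBundle.incl F V A p) = σ p) →
      ∀ p : TotalSpace F A, c.linearization U σ p =
        (AffineBundle.homogeneousLift c.lift).covDeriv U' σ' (AffineBundle.incl F V A p)) ∧
    ∀ p : TotalSpace F A, c.linearization U σ p =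
      SpanBundle.i₀ (c.lift.connector p
          (VectorField.mlieBracket 𝓘T(EB, F) (fun q => c.lift.projH q (U q))
            (fun q => vLift EB q (AffineBundle.bar σ q)) p))
        + vLiftInv EB (⟨p.1, σ p⟩ : TotalSpace (ℝ × F) (SpanBundle V A))
            (mfderiv 𝓘T(EB, F) 𝓘T(EB, ℝ × F)
              (fun q => (⟨q.1, σ q⟩ : TotalSpace (ℝ × F) (SpanBundle V A))) p
              (c.lift.projV p (U p)))
        + tangentDeriv (c.lift.projH p (U p)) (fun q => SpanBundle.j (σ q)) • SpanBundle.i₁ p.2 := by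
  have hA : IsManifold 𝓘T(EB, F) ∞ (TotalSpace F A) := AffineBundle.isManifold F V A ∞ 𝓘(ℝ, EB)
  have hn : (∞ : WithTop ℕ∞) ≠ 0 := by simp
  have hform : ∀ p : TotalSpace F A, ∃ (N : EB × F → EB →L[ℝ] F) (u : EB × F → EB × F)
      (s : EB × F → ℝ × F),
      (∀ᶠ q in 𝓝 p, c.lift.HasCoeffAt p q (N (extChartAt 𝓘T(EB, F) p q))) ∧
      DifferentiableAt ℝ N (extChartAt 𝓘T(EB, F) p p) ∧
      (∀ᶠ q in 𝓝 p, chartDeriv 𝓘T(EB, F) p q (U q) = u (extChartAt 𝓘T(EB, F) p q)) ∧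
      DifferentiableAt ℝ u (extChartAt 𝓘T(EB, F) p p) ∧
      (∀ᶠ q in 𝓝 p, (trivializationAt (ℝ × F) (SpanBundle V A) p.1 ⟨q.1, σ q⟩).2
        = s (extChartAt 𝓘T(EB, F) p q)) ∧
      DifferentiableAt ℝ s (extChartAt 𝓘T(EB, F) p p) := by
    intro p
    obtain ⟨u, hud, hu⟩ := exists_chartDeriv_field hn (ContMDiff.contMDiffAt hU (x := p))
    obtain ⟨s, hsd, hs⟩ := exists_section_coordinates hn (hσ.contMDiffAt (x := p))
    refine ⟨_, u, s, ?_, LiftData.differentiableAt_coeff hn c.contMDiff_projH p, hu, hud, hs, hsd⟩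
    filter_upwards [eventually_mem_extChartAt_source (I := 𝓘T(EB, F)) p] with q hq
    rw [(extChartAt 𝓘T(EB, F) p).left_inv hq]
    exact LiftData.hasCoeffAt_coeff (c.tangentProj_lift q) hq
  refine ⟨fun U' σ' hU' hσ' hUU' hσσ' p => ?_, fun p => ?_⟩
  -- Both claims compare vectors of one fibre of Ã, so equality of their coordinates suffices. The
  -- left sides have the same coordinate expression.
  all_goals
    obtain ⟨N, u, s, hN, hNd, hu, hud, hs, hsd⟩ := hform p
    apply linearMapAt_injective (mem_baseSet_trivializationAt (ℝ × F) (SpanBundle V A) p.1)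
    refine (AffineBundle.linearMapAt_covDeriv_homogeneous c.tangentProj_lift hN hNd hs hsd hu
      hud).trans ?_
    symm
  -- The complement of V is a neighbourhood of i₁(p), so smoothness on it gives smoothness at that
  -- point.
  · have hj := AffineBundle.eventually_j_ne_zero (V := V) p
    obtain ⟨u', hud', hu'⟩ := exists_chartDeriv_field hn (hU'.contMDiffAt hj)
    obtain ⟨s', hsd', hs'⟩ := exists_section_coordinates hn (hσ'.contMDiffAt hj)
    exact AffineBundle.linearMapAt_covDeriv_of_extension c.tangentProj_lift hN hNd hs (hUU' p)
      hu' hud' hσσ' hs' hsd'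
  · exact AffineBundle.linearMapAt_linearization_formula hN hNd hs hsd hu hud
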